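/- Let $\mathfrak{S}_n$ be the set of permutations $\pi=\pi(1)\cdots\pi(n)$ of $\{1,\dots,n\}$. For a pattern $\tau$ let $\mathfrak{S}_n(\tau)$ be the set of $\pi\in\mathfrak{S}_n$ with no subsequence order-isomorphic to $\tau$. Put $\mathsf{des}\,\pi=\#\{i: 1\le i<n,\ \pi(i)>\pi(i+1)\}$ and \begin{align*} (31\text{-}2)\,\pi&=\#\{(i,j): i+1<j\le n,\ \pi(i+1)<\pi(j)<\pi(i)\},\\ (2\text{-}31)\,\pi&=\#\{(i,j): j<i<n,\ \pi(i+1)<\pi(j)<\pi(i)\},\\ (2\text{-}13)\,\pi&=\#\{(i,j): j<i<n,\ \pi(i)<\pi(j)<\pi(i+1)\},\\ (13\text{-}2)\,\pi&=\#\{(i,j): i+1<j\le n,\ \pi(i)<\pi(j)<\pi(i+1)\}. \end{align*} With the convention $\pi(n+1)=n+1$, a foremaximum of $\pi$ is a letter $\pi(i)$, $1\le i\le n$, with $\pi(i)=\max\{\pi(1),\dots,\pi(i)\}$ and $\pi(i)<\pi(i+1)$. A coderangement is a permutation without foremaxima; $\mathfrak{D}^*_n(\tau)$ is the set of coderangements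 in $\mathfrak{S}_n(\tau)$. Let $\mathfrak{A}_n(\tau)$ be the set of alternating permutations $\pi(1)<\pi(2)>\pi(3)<\cdots$ in $\mathfrak{S}_n(\tau)$. Define $C_n(t,q)$ by the continued fraction $$\sum_{n\ge 0}C_n(t,q)z^n=\cfrac{1}{1-\cfrac{c_0z}{1-\cfrac{c_1z}{1-\cfrac{c_2z}{\ddots}}}},\qquad c_{2k}=q^{k},\quad c_{2k+1}=tq^{k}\quad(k\ge 0),$$ and let $C_n(q):=C_n(q,q^2)$ be Carlitz's $q$-Catalan numbers. Moreover put $$\widehat{C}_n(q):=\sum_{\pi\in\mathfrak{A}_{2n}(231)}q^{(13\text{-}2)\,\pi},\qquad \overline{C}_n(q):=\sum_{\pi\in\mathfrak{A}_{2n}(231)}q^{(2\text{-}13)\,\pi}.$$ **Theorem.** For every $n\ge 1$ the following identities hold for an indeterminate $q$ (equivalently, for every element $q$ of every commutative ring): \begin{align*} \sum_{\pi\in\mathfrak{S}_n(132)}(-1)^{\mathsf{des}\,\pi}q^{(2\text{-}31)\,\pi}&=\sum_{\pi\in\mathfrak{S}_n(132)}(-1)^{\mathsf{des}\,\pi}q^{(2\text{-}13)\,\pi}=\begin{cases}0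 & n\text{ even},\\ (-q)^{\frac{n-1}{2}}C_{\frac{n-1}{2}}(q^2) & n\text{ odd},\end{cases}\\ \sum_{\pi\in\mathfrak{S}_n(213)}(-1)^{\mathsf{des}\,\pi}q^{(31\text{-}2)\,\pi}&=\sum_{\pi\in\mathfrak{S}_n(213)}(-1)^{\mathsf{des}\,\pi}q^{(13\text{-}2)\,\pi}=\begin{cases}0 & n\text{ even},\\ (-q)^{\frac{n-1}{2}}C_{\frac{n-1}{2}}(q^2) & n\text{ odd},\end{cases}\\ \sum_{\pi\in\mathfrak{S}_n(312)}(-1)^{\mathsf{des}\,\pi}q^{(2\text{-}31)\,\pi}&=\sum_{\pi\in\mathfrak{S}_n(312)}(-1)^{\mathsf{des}\,\pi}q^{(2\text{-}13)\,\pi}=\begin{cases}0 & n\text{ even},\\ (-q)^{\frac{n-1}{2}}C_{\frac{n-1}{2}}(q^2) & n\text{ odd},\end{cases}\\ \sum_{\pi\in\mathfrak{D}^*_n(132)}(-1)^{\mathsf{des}\,\pi}q^{(2\text{-}31)\,\pi}&=\begin{cases}(-1)^{\frac n2}\widehat{C}_{\frac n2}(q) & n\text{ even},\\ 0 & n\text{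 odd},\end{cases}\\ \sum_{\pi\in\mathfrak{D}^*_n(132)}(-q)^{\mathsf{des}\,\pi}q^{(31\text{-}2)\,\pi}&=\begin{cases}(-q)^{\frac n2}\overline{C}_{\frac n2}(q) & n\text{ even},\\ 0 & n\text{ odd},\end{cases}\\ \sum_{\pi\in\mathfrak{D}^*_n(213)}(-1)^{\mathsf{des}\,\pi}q^{(13\text{-}2)\,\pi}&=\begin{cases}(-1)^{\frac n2}q^{\frac{n-2}{2}}C_{\frac{n-2}{2}}(q^2) & n\text{ even},\\ 0 & n\text{ odd},\end{cases}\\ \sum_{\pi\in\mathfrak{D}^*_n(213)}(-q)^{\mathsf{des}\,\pi}q^{(31\text{-}2)\,\pi}&=\begin{cases}(-1)^{\frac n2}q^{\frac{3n-4}{2}}C_{\frac{n-2}{2}}(q^2) & n\text{ even},\\ 0 & n\text{ odd}.\end{cases} \end{align*} -/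

import Mathlib

namespace QCatalan

/-! ### Permutation statistics

A permutation `π` of `{1, …, n}` is an element of `Equiv.Perm (Fin n)`, positions and values both
being shifted down by one; all notions below depend only on the order of positions and values. -/

section Permutations

variable {n : ℕ}

/-- `π` avoids the pattern with one-line notation `p`: no subsequence of `π` is order-isomorphic
to `p`. -/
def Avoids {k : ℕ} (p : Fin k → ℕ) (π : Equiv.Perm (Fin n)) : Prop :=
  ¬ ∃ f : Fin k → Fin n, (∀ a b, a < b → f a < f b) ∧
    ∀ a b, (π (f a) < π (f b) ↔ p a < p b)

instance {k : ℕ} (p : Fin k → ℕ) : DecidablePred (Avoids (n := n) p) := fun π => by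
  unfold Avoids; infer_instance

/-- The number of descents. With the convention `π(n+1) = n+1` the last position is never a
descent. -/
def des (π : Equiv.Perm (Fin n)) : ℕ :=
  (Finset.univ.filter fun i : Fin n => ∃ h : i.val + 1 < n, π ⟨i.val + 1, h⟩ < π i).card

/-- Occurrences of the vincular pattern `31-2`:
pairs `(i, j)` with `i + 1 < j` and `π(i+1) < π(j) < π(i)`. -/
def vinc31_2 (π : Equiv.Perm (Fin n)) : ℕ :=
  (Finset.univ.filter fun x : Fin n × Fin n => x.1.val + 1 < x.2.val ∧
    ∃ h : x.1.val + 1 < n, π ⟨x.1.val + 1, h⟩ < π x.2 ∧ π x.2 < π x.1).card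

/-- Occurrences of the vincular pattern `2-31`:
pairs `(i, j)` with `j < i < n` and `π(i+1) < π(j) < π(i)`. -/
def vinc2_31 (π : Equiv.Perm (Fin n)) : ℕ :=
  (Finset.univ.filter fun x : Fin n × Fin n => x.2 < x.1 ∧
    ∃ h : x.1.val + 1 < n, π ⟨x.1.val + 1, h⟩ < π x.2 ∧ π x.2 < π x.1).card

/-- Occurrences of the vincular pattern `2-13`:
pairs `(i, j)` with `j < i < n` and `π(i) < π(j) < π(i+1)`. -/
def vinc2_13 (π : Equiv.Perm (Fin n)) : ℕ :=
  (Finset.univ.filter fun x : Fin n × Fin n => x.2 < x.1 ∧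
    ∃ h : x.1.val + 1 < n, π x.1 < π x.2 ∧ π x.2 < π ⟨x.1.val + 1, h⟩).card

/-- Occurrences of the vincular pattern `13-2`:
pairs `(i, j)` with `i + 1 < j` and `π(i) < π(j) < π(i+1)`. -/
def vinc13_2 (π : Equiv.Perm (Fin n)) : ℕ :=
  (Finset.univ.filter fun x : Fin n × Fin n => x.1.val + 1 < x.2.val ∧
    ∃ h : x.1.val + 1 < n, π x.1 < π x.2 ∧ π x.2 < π ⟨x.1.val + 1, h⟩).card

/-- The number of foremaxima: left-to-right maxima that are also ascent bottoms. With the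
convention `π(n+1) = n+1` the last letter is always an ascent bottom. -/
def fmax (π : Equiv.Perm (Fin n)) : ℕ :=
  (Finset.univ.filter fun i : Fin n => (∀ j, j ≤ i → π j ≤ π i) ∧
    ∀ h : i.val + 1 < n, π i < π ⟨i.val + 1, h⟩).card

/-- Alternating (up-down) permutations: `π(1) < π(2) > π(3) < ⋯`. -/
def IsAlternating (π : Equiv.Perm (Fin n)) : Prop :=
  ∀ (i : Fin n) (h : i.val + 1 < n),
    if Even i.val then π i < π ⟨i.val + 1, h⟩ else π ⟨i.val + 1, h⟩ < π i

instance : DecidablePred (IsAlternating (n := n)) := fun π => by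
  unfold IsAlternating; infer_instance

end Permutations

/-- Permutations of length `n` avoiding `p`. -/
def avoiding (n : ℕ) {k : ℕ} (p : Fin k → ℕ) : Finset (Equiv.Perm (Fin n)) :=
  Finset.univ.filter fun π => Avoids p π

/-- Coderangements of length `n` avoiding `p`. -/
def coderAvoiding (n : ℕ) {k : ℕ} (p : Fin k → ℕ) : Finset (Equiv.Perm (Fin n)) :=
  Finset.univ.filter fun π => fmax π = 0 ∧ Avoids p π

/-- Alternating permutations of length `n` avoiding `p`. -/
def altAvoiding (n : ℕ) {k : ℕ} (p : Fin k → ℕ) : Finset (Equiv.Perm (Fin n)) :=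
  Finset.univ.filter fun π => IsAlternating π ∧ Avoids p π

/-! ### Continued fractions and `q`-Catalan numbers -/

section Catalan

variable {R : Type*} [CommRing R]

/-- The convergent `1 / (1 - c₀ z / (1 - c₁ z / (⋯ / (1 - c_{d-1} z))))` as a power series in
`z`. -/
noncomputable def cfConvergent : ℕ → (ℕ → R) → PowerSeries R
  | 0, _ => 1
  | d + 1, c => PowerSeries.invOfUnit
      (1 - PowerSeries.X * (PowerSeries.C (c 0) * cfConvergent d (fun i => c (i + 1)))) 1

/-- The infinite continued fraction `1 / (1 - c₀ z / (1 - c₁ z / ⋯))`: its coefficient of `z ^ n`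
is that of all convergents of depth at least `n`. -/
noncomputable def contFrac (c : ℕ → R) : PowerSeries R :=
  PowerSeries.mk fun n => PowerSeries.coeff n (cfConvergent n c)

theorem cfConvergent_succ (d : ℕ) (c : ℕ → R) :
    cfConvergent (d + 1) c = 1 + PowerSeries.X * (PowerSeries.C (c 0) *
      (cfConvergent d (fun i => c (i + 1)) * cfConvergent (d + 1) c)) := by
  have h : (1 - PowerSeries.X * (PowerSeries.C (c 0) * cfConvergent d (fun i => c (i + 1)))) *
      cfConvergent (d + 1) c = 1 :=
    PowerSeries.mul_invOfUnit _ 1 (by simp)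
  linear_combination h

theorem coeff_zero_cfConvergent (d : ℕ) (c : ℕ → R) :
    PowerSeries.coeff 0 (cfConvergent d c) = 1 := by
  cases d with
  | zero => simp [cfConvergent]
  | succ d => rw [cfConvergent_succ]; simp

/-- The coefficient of `z ^ m` is the same in all convergents of depth at least `m`. -/
theorem coeff_cfConvergent_eq (m : ℕ) : ∀ (d e : ℕ) (c : ℕ → R), m ≤ d → m ≤ e →
    PowerSeries.coeff m (cfConvergent d c) = PowerSeries.coeff m (cfConvergent e c) := by
  induction m using Nat.strong_induction_on with
  | _ m ih =>
    intro d e c hd he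
    cases m with
    | zero => rw [coeff_zero_cfConvergent, coeff_zero_cfConvergent]
    | succ m =>
      obtain ⟨d, rfl⟩ : ∃ d', d = d' + 1 := ⟨d - 1, by omega⟩
      obtain ⟨e, rfl⟩ : ∃ e', e = e' + 1 := ⟨e - 1, by omega⟩
      rw [cfConvergent_succ d, cfConvergent_succ e]
      simp only [map_add, PowerSeries.coeff_succ_X_mul, PowerSeries.coeff_C_mul]
      rw [PowerSeries.coeff_mul, PowerSeries.coeff_mul]
      congr 2
      refine Finset.sum_congr rfl fun x hx => ?_
      have := Finset.HasAntidiagonal.mem_antidiagonal.1 hx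
      rw [ih x.1 (by omega) d e _ (by omega) (by omega),
        ih x.2 (by omega) (d + 1) (e + 1) _ (by omega) (by omega)]

/-- The continued fraction satisfies `F = 1 / (1 - c₀ z G)`, where `G` is the continued fraction
with the first numerator removed. -/
theorem contFrac_eq (c : ℕ → R) :
    contFrac c = 1 + PowerSeries.X * (PowerSeries.C (c 0) *
      (contFrac (fun i => c (i + 1)) * contFrac c)) := by
  ext m
  cases m with
  | zero => simp [contFrac, cfConvergent]
  | succ m =>
    rw [contFrac, PowerSeries.coeff_mk, cfConvergent_succ]
    simp only [map_add, PowerSeries.coeff_succ_X_mul, PowerSeries.coeff_C_mul]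
    rw [PowerSeries.coeff_mul, PowerSeries.coeff_mul]
    congr 2
    refine Finset.sum_congr rfl fun x hx => ?_
    have := Finset.HasAntidiagonal.mem_antidiagonal.1 hx
    simp only [contFrac, PowerSeries.coeff_mk]
    rw [coeff_cfConvergent_eq x.1 m x.1 _ (by omega) le_rfl,
      coeff_cfConvergent_eq x.2 (m + 1) x.2 _ (by omega) le_rfl]

/-- The partial numerators `1, t, q, tq, q², tq², …`. -/
def qtNumerator (t q : R) (i : ℕ) : R :=
  if Even i then q ^ (i / 2) else t * q ^ (i / 2)

/-- The `(q,t)`-Catalan number `C_n(t,q)`. -/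
noncomputable def qtCatalan (n : ℕ) (t q : R) : R :=
  PowerSeries.coeff n (contFrac (qtNumerator t q))

/-- Carlitz's `q`-Catalan number `C_n(q) = C_n(q, q²)`. -/
noncomputable def carlitzCatalan (n : ℕ) (q : R) : R :=
  qtCatalan n q (q ^ 2)

/-- `Ĉ_n(q)`, the sum of `q ^ (13-2) π` over the `231`-avoiding alternating permutations of length
`2n`. -/
def catalanHat (n : ℕ) (q : R) : R :=
  ∑ π ∈ altAvoiding (2 * n) ![2, 3, 1], q ^ vinc13_2 π

/-- `C̄_n(q)`, the sum of `q ^ (2-13) π` over the `231`-avoiding alternating permutations of length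
`2n`. -/
def catalanBar (n : ℕ) (q : R) : R :=
  ∑ π ∈ altAvoiding (2 * n) ![2, 3, 1], q ^ vinc2_13 π

end Catalan

end QCatalan

open QCatalan

/-! A `132`-avoiding word splits uniquely at its largest letter: every letter before it exceeds
every letter after it, and both sides avoid `132` again. Such words are therefore binary trees, and
each statistic is additive over the two subtrees up to a correction at the root. New occurrences of
`2-31` come from the descent out of the root, which straddles the values of the whole left word. New
`2-13` come from the ascent into the root and count the left letters above the last left letter; new
`31-2` come from the descent out of the root and count the right letters above the first right
letter. The last two corrections are tracked by a variable `u`, and a factor `q ^ |l|` turns into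
the substitution `z ↦ qz`.

Each weighted sum is thus a coefficient of a series with a functional equation, and such an equation
has only one solution: the difference of two solutions has the form excluded by
`eq_zero_of_eq_X_mul`. For `F = ∑ (-q)ᵐ C_m(q²) z²ᵐ` the continued fraction gives `F(z) = 1 - q z²
F(z) F(qz)` (`signedCarlitz_eq`). The signs make the tree equations collapse onto this one: both
signed series over all words are `1 + zF`, the auxiliary series is `F / (1 - zF)`
(`mul_eq_signedCarlitz`), and the two coderangement series for `213` are `1 - z² F(z)` and `1 - q z²
F(qz)`.

For the coderangements avoiding `132` two recursions are compared instead. The signed series of all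
nonempty words equals that of the alternating words of odd length. A coderangement has a
coderangement on the left and an arbitrary nonempty word on the right, whereas an even alternating
word has an even one on the left and an odd one on the right, so the two series agree as well
(`treeGF_coder_2_31_eq`, `treeGF_coder_31_2_eq`).

Reversal and complementation carry `132` to `213`, `312` and `231` and exchange the statistics.
Complementation replaces `des` by `n - 1 - des`, a global sign that is trivial for odd `n` and
irrelevant for even `n`, where the sum vanishes. -/

namespace QCatalan

open BinaryTree

/-! ### Generating functions over binary trees -/

section TreeSeries

variable {R : Type*} [CommRing R]

/-- The power series whose `n`-th coefficient is the total weight of the trees with `n` nodes. -/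
noncomputable def treeGF (w : BinaryTree Unit → R) : PowerSeries R :=
  PowerSeries.mk fun n => ∑ t ∈ treesOfNumNodesEq n, w t

@[simp]
theorem coeff_treeGF (w : BinaryTree Unit → R) (n : ℕ) :
    PowerSeries.coeff n (treeGF w) = ∑ t ∈ treesOfNumNodesEq n, w t :=
  PowerSeries.coeff_mk _ _

theorem sum_treesOfNumNodesEq_succ (w : BinaryTree Unit → R) (n : ℕ) :
    ∑ t ∈ treesOfNumNodesEq (n + 1), w t =
      ∑ ij ∈ Finset.HasAntidiagonal.antidiagonal n, ∑ l ∈ treesOfNumNodesEq ij.1,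
        ∑ r ∈ treesOfNumNodesEq ij.2, w (l △ r) := by
  rw [treesOfNumNodesEq_succ, Finset.sum_biUnion]
  · simp only [pairwiseNode, Finset.sum_map, Finset.sum_product]
    rfl
  · rintro ⟨a, b⟩ - ⟨c, d⟩ - hne
    refine Finset.disjoint_left.2 fun t h1 h2 => hne ?_
    simp only [pairwiseNode, Finset.mem_map, Finset.mem_product, mem_treesOfNumNodesEq] at h1 h2
    obtain ⟨x, ⟨rfl, rfl⟩, rfl⟩ := h1
    obtain ⟨y, ⟨rfl, rfl⟩, h⟩ := h2
    obtain ⟨-, h1, h2⟩ := node.inj (h : node () y.1 y.2 = node () x.1 x.2)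
    rw [h1, h2]

/-- Splitting at the root is a Cauchy product. Two products are allowed because the weight often
takes one form for an empty right subtree and another for a nonempty one. -/
theorem treeGF_of_node_add {w α β γ δ : BinaryTree Unit → R}
    (h : ∀ l r, w (l △ r) = α l * β r + γ l * δ r) :
    treeGF w = PowerSeries.C (w nil) +
      PowerSeries.X * (treeGF α * treeGF β + treeGF γ * treeGF δ) := by
  ext n
  cases n with
  | zero => simp
  | succ n =>
    rw [coeff_treeGF, sum_treesOfNumNodesEq_succ, map_add, PowerSeries.coeff_succ_X_mul, map_add,
      PowerSeries.coeff_mul, PowerSeries.coeff_mul, ← Finset.sum_add_distrib]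
    simp [h, Finset.sum_add_distrib, Finset.sum_mul_sum]

theorem treeGF_of_node {w α β : BinaryTree Unit → R} (h : ∀ l r, w (l △ r) = α l * β r) :
    treeGF w = PowerSeries.C (w nil) + PowerSeries.X * (treeGF α * treeGF β) := by
  have := treeGF_of_node_add (w := w) (α := α) (β := β) (γ := 0) (δ := 0) (by simpa using h)
  have h0 : treeGF (0 : BinaryTree Unit → R) = 0 := by ext; simp
  simpa [h0] using this

/-- `0` for the empty tree and `1` otherwise. -/
def nodeInd : BinaryTree Unit → ℕ
  | .nil => 0
  | .node _ _ _ => 1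

@[simp] theorem nodeInd_nil : nodeInd nil = 0 := rfl

@[simp] theorem nodeInd_node (v : Unit) (l r : BinaryTree Unit) : nodeInd (node v l r) = 1 := rfl

/-- The factor `1 - nodeInd` selects the empty subtree and `nodeInd` the nonempty ones, so case
distinctions at the root become sums of products. -/
theorem treeGF_nilInd : treeGF (fun t => 1 - (nodeInd t : R)) = 1 := by
  have h0 : treeGF (0 : BinaryTree Unit → R) = 0 := by ext; simp
  rw [treeGF_of_node (α := 0) (β := 0) (by simp), h0]
  simp

theorem treeGF_nodeInd_mul (w : BinaryTree Unit → R) :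
    treeGF (fun t => (nodeInd t : R) * w t) = treeGF w - PowerSeries.C (w nil) := by
  ext n
  cases n with
  | zero => rw [coeff_treeGF, map_sub, coeff_treeGF]; simp
  | succ n =>
    simp only [coeff_treeGF, map_sub, PowerSeries.coeff_C, Nat.succ_ne_zero, if_false, sub_zero,
      sum_treesOfNumNodesEq_succ, nodeInd_node, Nat.cast_one, one_mul]

theorem treeGF_const_mul (c : R) (w : BinaryTree Unit → R) :
    treeGF (fun t => c * w t) = PowerSeries.C c * treeGF w := by
  ext; simp [Finset.mul_sum]

theorem treeGF_add (v w : BinaryTree Unit → R) :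
    treeGF (fun t => v t + w t) = treeGF v + treeGF w := by
  ext; simp [Finset.sum_add_distrib]

theorem treeGF_pow_numNodes_mul (q : R) (w : BinaryTree Unit → R) :
    treeGF (fun t => q ^ t.numNodes * w t) = PowerSeries.rescale q (treeGF w) := by
  ext n
  simp only [coeff_treeGF, PowerSeries.coeff_rescale, Finset.mul_sum]
  exact Finset.sum_congr rfl fun t ht => by rw [mem_treesOfNumNodesEq.1 ht]

/-- A power series satisfying a homogeneous linear `q`-difference equation of the form
`D = z (P D + Q D(qz))` vanishes. -/
theorem eq_zero_of_eq_X_mul {D P Q : PowerSeries R} {q : R}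
    (h : D = PowerSeries.X * (P * D + Q * PowerSeries.rescale q D)) : D = 0 := by
  ext n
  induction n using Nat.strong_induction_on with
  | _ n ih =>
    rw [h]
    cases n with
    | zero => simp
    | succ n =>
      rw [PowerSeries.coeff_succ_X_mul, map_add, PowerSeries.coeff_mul, PowerSeries.coeff_mul]
      -- The factor `X` lowers the degree, so only coefficients of `D` of smaller index enter, and
      -- these vanish by induction.
      have hz : ∀ x ∈ Finset.HasAntidiagonal.antidiagonal n, PowerSeries.coeff x.2 D = 0 := fun x hx => by
        have := Finset.HasAntidiagonal.mem_antidiagonal.1 hx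
        simpa using ih x.2 (by omega)
      rw [Finset.sum_eq_zero fun x hx => by rw [hz x hx, mul_zero],
        Finset.sum_eq_zero fun x hx => by
          rw [PowerSeries.coeff_rescale, hz x hx, mul_zero, mul_zero]]
      simp

end TreeSeries

/-! ### The Carlitz series -/

section Carlitz

variable {R : Type*} [CommRing R]

-- Every partial numerator comes with one factor `z`, so scaling all of them by `q` is the
-- substitution `z ↦ qz`.
open PowerSeries in
theorem cfConvergent_const_mul (q : R) (d : ℕ) : ∀ c : ℕ → R,
    cfConvergent d (fun i => q * c i) = rescale q (cfConvergent d c) := by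
  induction d with
  | zero => intro c; simp [cfConvergent]
  | succ d ih =>
    intro c
    have h1 := cfConvergent_succ d c
    have h2 := cfConvergent_succ d (fun i => q * c i)
    have h3 := congrArg (rescale q) h1
    rw [ih (fun i => c (i + 1))] at h2
    simp only [map_add, map_mul, map_one, rescale_X] at h3
    have hC : rescale q (C (c 0)) = C (c 0) := by
      ext n; cases n <;> simp [coeff_C]
    rw [hC] at h3
    rw [map_mul] at h2
    -- Only `D` itself occurs in the equation for the difference, hence the dummy values `Q = 0` and
    -- `q = 0`.
    refine sub_eq_zero.1 (eq_zero_of_eq_X_mul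
      (P := C q * C (c 0) * rescale q (cfConvergent d (fun i => c (i + 1)))) (Q := 0) (q := 0) ?_)
    linear_combination h2 - h3

open PowerSeries in
theorem contFrac_const_mul (q : R) (c : ℕ → R) :
    contFrac (fun i => q * c i) = rescale q (contFrac c) := by
  ext n
  simp [contFrac, cfConvergent_const_mul]

theorem qtNumerator_sq (q : R) : qtNumerator q (q ^ 2) = fun i => q ^ i := by
  funext i
  rcases Nat.even_or_odd' i with ⟨k, rfl | rfl⟩
  · simp [qtNumerator, pow_mul]
  · have : (2 * k + 1) / 2 = k := by omega
    simp only [qtNumerator, this, Nat.not_even_two_mul_add_one, if_false, pow_succ', pow_mul]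

-- The numerators are `1, q, q², …`; deleting the first one multiplies the sequence by `q`, so the
-- tail of the continued fraction is the same series at `qz`.
open PowerSeries in
theorem carlitz_series (q : R) :
    (mk fun n => carlitzCatalan n q) = 1 + X * ((mk fun n => carlitzCatalan n q) *
      rescale q (mk fun n => carlitzCatalan n q)) := by
  have h : (mk fun n => carlitzCatalan n q) = contFrac (fun i => q ^ i) := by
    ext n; simp [carlitzCatalan, qtCatalan, qtNumerator_sq]
  rw [h, ← contFrac_const_mul]
  conv_lhs => rw [contFrac_eq]
  simp [pow_succ', mul_comm]

/-- The series `∑ (-q)ᵐ C_m(q²) z²ᵐ`. -/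
noncomputable def signedCarlitz (q : R) : PowerSeries R :=
  PowerSeries.expand 2 two_ne_zero
    (PowerSeries.rescale (-q) (PowerSeries.mk fun n => carlitzCatalan n (q ^ 2)))

theorem coeff_signedCarlitz (q : R) (n : ℕ) :
    PowerSeries.coeff n (signedCarlitz q) =
      if Even n then (-q) ^ (n / 2) * carlitzCatalan (n / 2) (q ^ 2) else 0 := by
  simp [signedCarlitz, PowerSeries.coeff_expand, even_iff_two_dvd]

open PowerSeries in
theorem rescale_expand_two (q : R) (f : PowerSeries R) :
    rescale q (expand 2 two_ne_zero f) = expand 2 two_ne_zero (rescale (q ^ 2) f) := by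
  ext n
  simp only [coeff_rescale, coeff_expand]
  split_ifs with h
  · obtain ⟨k, rfl⟩ := h
    simp [pow_mul]
  · simp

-- This is `carlitz_series` at `q²` with `-q z²` substituted for its variable: dilating `z²` by `q²`
-- is dilating `z` by `q`.
open PowerSeries in
theorem signedCarlitz_eq (q : R) :
    signedCarlitz q = 1 - C q * X ^ 2 * (signedCarlitz q * rescale q (signedCarlitz q)) := by
  have h := congrArg (fun f => expand 2 two_ne_zero (rescale (-q) f)) (carlitz_series (q ^ 2))
  simp only [map_add, map_mul, map_one, rescale_X, expand_X] at h
  have h2 : expand 2 two_ne_zero (rescale (-q) (rescale (q ^ 2)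
      (mk fun n => carlitzCatalan n (q ^ 2)))) = rescale q (signedCarlitz q) := by
    rw [signedCarlitz, rescale_expand_two, rescale_rescale, rescale_rescale, mul_comm]
  rw [h2] at h
  have h3 : expand 2 two_ne_zero (C (-q)) = C (-q) := expand_C _ _ _
  rw [h3, map_neg] at h
  conv_lhs => rw [signedCarlitz, h]
  rw [signedCarlitz]
  ring

end Carlitz

/-! ### Statistics on binary trees

A binary tree encodes the `132`-avoiding word in which the root is the largest letter, preceded by
the word of the left subtree and followed by that of the right subtree, every letter of the former
being larger than every letter of the latter. -/

/-- The number of descents of the word of a tree. -/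
def treeDes : BinaryTree Unit → ℕ
  | .nil => 0
  | .node _ l r => treeDes l + treeDes r + nodeInd r

/-- The number of occurrences of `2-31` in the word of a tree. -/
def tree2_31 : BinaryTree Unit → ℕ
  | .nil => 0
  | .node _ l r => tree2_31 l + tree2_31 r + l.numNodes * nodeInd r

/-- The number of letters exceeding the last letter in the word of a tree. -/
def treeAboveLast : BinaryTree Unit → ℕ
  | .nil => 0
  | .node _ l r => nodeInd r * (l.numNodes + 1 + treeAboveLast r)

/-- The number of occurrences of `2-13` in the word of a tree. -/
def tree2_13 : BinaryTree Unit → ℕ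
  | .nil => 0
  | .node _ l r => tree2_13 l + tree2_13 r + treeAboveLast l

/-- The number of letters exceeding the first letter in the word of a tree. -/
def treeAboveFirst : BinaryTree Unit → ℕ
  | .nil => 0
  | .node _ l _ => nodeInd l * (treeAboveFirst l + 1)

/-- The number of occurrences of `31-2` in the word of a tree. -/
def tree31_2 : BinaryTree Unit → ℕ
  | .nil => 0
  | .node _ l r => tree31_2 l + tree31_2 r + treeAboveFirst r

/-- No left-to-right maximum is an ascent bottom in the word of a tree. -/
def TreeCoder : BinaryTree Unit → Prop
  | .nil => True
  | .node _ l r => TreeCoder l ∧ r ≠ .nil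

/-- No right-to-left minimum is an ascent top in the word of a tree. -/
def TreeNoMinTop : BinaryTree Unit → Prop
  | .nil => True
  | .node _ l r => (r = .nil → l = .nil) ∧ TreeNoMinTop r

/-- No right-to-left minimum is the first letter or an ascent top in the word of a tree. -/
def TreeRevCoder : BinaryTree Unit → Prop
  | .nil => True
  | .node _ _ r => r ≠ .nil ∧ TreeNoMinTop r

/-- The word of a tree is alternating of odd length, starting with an ascent. -/
def TreeAltOdd : BinaryTree Unit → Prop
  | .nil => False
  | .node _ l r => (l = .nil ∧ r = .nil) ∨ (TreeAltOdd l ∧ TreeAltOdd r)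

/-- The word of a tree is alternating of even length, starting with a descent. -/
def TreeAltEven : BinaryTree Unit → Prop
  | .nil => True
  | .node _ l r => TreeAltEven l ∧ TreeAltOdd r

theorem TreeAltOdd.odd : ∀ {t : BinaryTree Unit}, TreeAltOdd t → Odd t.numNodes
  | .nil, h => h.elim
  | .node _ l r, h => by
    rcases h with ⟨rfl, rfl⟩ | ⟨hl, hr⟩
    · simp
    · simpa [parity_simps, TreeAltOdd.odd hl] using TreeAltOdd.odd hr

theorem TreeAltEven.even : ∀ {t : BinaryTree Unit}, TreeAltEven t → Even t.numNodes
  | .nil, _ => by simp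
  | .node _ l r, h => by
    have h1 := TreeAltEven.even h.1
    have h2 := h.2.odd
    simp only [numNodes]
    exact (h1.add_odd h2).add_one

/-! ### Functional equations of the tree series -/

section Series

variable {R : Type*} [CommRing R]

open PowerSeries Classical

/-- Weight by descents and occurrences of `2-31`. -/
def wt2_31 (y q : R) (t : BinaryTree Unit) : R := y ^ treeDes t * q ^ tree2_31 t

/-- Signed weight by occurrences of `2-13` and letters above the last one. -/
def wt2_13 (u q : R) (t : BinaryTree Unit) : R :=
  (-1) ^ treeDes t * q ^ tree2_13 t * u ^ treeAboveLast t

/-- Weight by descents, occurrences of `31-2` and letters above the first one. -/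
def wt31_2 (y u q : R) (t : BinaryTree Unit) : R :=
  y ^ treeDes t * q ^ tree31_2 t * u ^ treeAboveFirst t

theorem treeGF_wt2_31 (y q : R) :
    treeGF (wt2_31 y q) = 1 + X * (treeGF (wt2_31 y q) +
      C y * rescale q (treeGF (wt2_31 y q)) * (treeGF (wt2_31 y q) - 1)) := by
  conv_lhs => rw [treeGF_of_node_add (w := wt2_31 y q) (α := wt2_31 y q)
    (β := fun t => 1 - (nodeInd t : R)) (γ := fun t => q ^ t.numNodes * wt2_31 y q t)
    (δ := fun t => y * ((nodeInd t : R) * wt2_31 y q t)) (by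
      rintro l (_ | ⟨_, a, b⟩)
      · simp [wt2_31, treeDes, tree2_31]
      · simp [wt2_31, treeDes, tree2_31]; ring)]
  rw [treeGF_nilInd, treeGF_pow_numNodes_mul, treeGF_const_mul, treeGF_nodeInd_mul]
  simp [wt2_31, treeDes, tree2_31]
  ring

theorem treeGF_wt2_13 (u q : R) :
    treeGF (wt2_13 u q) = 1 + X * (treeGF (wt2_13 q q) -
      C u * rescale u (treeGF (wt2_13 q q)) * (treeGF (wt2_13 u q) - 1)) := by
  -- The left weight has `u = q`, since the ascent into the root creates `treeAboveLast l`
  -- occurrences. If the right subtree is nonempty, the last letter lies in it, below all `|l| + 1`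
  -- letters of the left word and the root: hence `u ^ |l|` and the extra `u`.
  conv_lhs => rw [treeGF_of_node_add (w := wt2_13 u q) (α := wt2_13 q q)
    (β := fun t => 1 - (nodeInd t : R)) (γ := fun t => u ^ t.numNodes * wt2_13 q q t)
    (δ := fun t => -u * ((nodeInd t : R) * wt2_13 u q t)) (by
      rintro l (_ | ⟨_, a, b⟩)
      · simp [wt2_13, treeDes, tree2_13, treeAboveLast]; ring
      · simp only [wt2_13, treeDes, tree2_13, treeAboveLast.eq_2 _ l, nodeInd_node]
        push_cast; ring)]
  rw [treeGF_nilInd, treeGF_pow_numNodes_mul, treeGF_const_mul, treeGF_nodeInd_mul]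
  simp [wt2_13, treeDes, tree2_13, treeAboveLast]
  ring

/-- The weight factors completely. A nonempty left word contains the first letter, and the root is
one more letter above it (factor `u`); a nonempty right word adds a descent (factor `y`) and
`treeAboveFirst r` occurrences (`u = q`). -/
theorem treeGF_wt31_2 (y u q : R) :
    treeGF (wt31_2 y u q) = 1 + X * ((1 + C u * (treeGF (wt31_2 y u q) - 1)) *
      (1 + C y * (treeGF (wt31_2 y q q) - 1))) := by
  conv_lhs => rw [treeGF_of_node (w := wt31_2 y u q)
    (α := fun t => (1 - (nodeInd t : R)) + u * ((nodeInd t : R) * wt31_2 y u q t))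
    (β := fun t => (1 - (nodeInd t : R)) + y * ((nodeInd t : R) * wt31_2 y q q t)) (by
      rintro (_ | ⟨_, c, d⟩) (_ | ⟨_, a, b⟩)
      · simp [wt31_2, treeDes, tree31_2, treeAboveFirst]
      · simp [wt31_2, treeDes, tree31_2, treeAboveFirst]; ring
      · simp [wt31_2, treeDes, tree31_2, treeAboveFirst]; ring
      · simp only [wt31_2, treeDes, tree31_2, treeAboveFirst.eq_2 _ (node _ c d), nodeInd_node]
        push_cast; ring)]
  rw [treeGF_add, treeGF_add, treeGF_nilInd, treeGF_const_mul, treeGF_nodeInd_mul,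
    treeGF_const_mul, treeGF_nodeInd_mul]
  simp [wt31_2, treeDes, tree31_2, treeAboveFirst]

theorem treeGF_signed_2_31 (q : R) : treeGF (wt2_31 (-1) q) = 1 + X * signedCarlitz q := by
  have hA := treeGF_wt2_31 (-1) q
  have hF := signedCarlitz_eq q
  set A := treeGF (wt2_31 (-1) q)
  set F := signedCarlitz q
  -- Putting `1 + XF` for `A` in `hA` leaves `X (1 - q X² F(z) F(qz))` beside the `1`, which is `XF`
  -- again by `hF`.
  refine sub_eq_zero.1 (eq_zero_of_eq_X_mul (q := q) (P := 1 - rescale q A)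
    (Q := -(X * F)) ?_)
  simp only [map_neg, map_one, map_sub, map_add, map_mul, rescale_X] at *
  linear_combination hA - X * hF

theorem isUnit_one_sub_X_mul (F : PowerSeries R) : IsUnit (1 - X * F) := by
  rw [PowerSeries.isUnit_iff_constantCoeff]; simp

/-- The functional equation shared by the refined `2-13` and `2-31` series has the solution
`F / (1 - z F)`. -/
theorem mul_eq_signedCarlitz {q : R} {B : PowerSeries R}
    (hB : B = 1 + X * (B - C q * rescale q B * (B - 1))) :
    B * (1 - X * signedCarlitz q) = signedCarlitz q := by
  have hF := signedCarlitz_eq q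
  set F := signedCarlitz q
  -- With `V` the inverse of `1 - XF`, the candidate `FV` is shown to satisfy the equation of `B`,
  -- and uniqueness then gives `B = FV`.
  obtain ⟨V, hV⟩ := (isUnit_one_sub_X_mul F).exists_right_inv
  have hV' := congrArg (rescale q) hV
  simp only [map_mul, map_sub, map_one, rescale_X] at hV'
  set F' := rescale q F
  set V' := rescale q V
  have hY : F * V = 1 + X * (F * V - C q * (F' * V') * (F * V - 1)) := by
    linear_combination V * V' * hF + V' * hV + (V * F * X - (F * V - 1)) * hV'
  have hBY : B = F * V := by
    refine sub_eq_zero.1 (eq_zero_of_eq_X_mul (q := q) (P := 1 - C q * rescale q B)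
      (Q := -(C q * (F * V - 1))) ?_)
    simp only [map_sub, map_mul]
    linear_combination hB - hY
  rw [hBY]
  linear_combination F * hV

theorem treeGF_signed_2_13 (q : R) : treeGF (wt2_13 1 q) = 1 + X * signedCarlitz q := by
  have hA := treeGF_wt2_13 1 q
  have hB := mul_eq_signedCarlitz (treeGF_wt2_13 q q)
  simp only [map_one, one_mul, rescale_one, RingHom.id_apply] at hA
  set A := treeGF (wt2_13 1 q)
  set B := treeGF (wt2_13 q q)
  set F := signedCarlitz q
  -- At `u = 1` the equation for `A` is linear with no dilation: `A - 1 = XB / (1 + XB)`, which is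
  -- `XF` because `B = F / (1 - XF)`.
  refine sub_eq_zero.1 (eq_zero_of_eq_X_mul (q := q) (P := -B) (Q := 0) ?_)
  linear_combination hA + X * hB

/-! ### Coderangements and alternating words -/

theorem treeGF_coder_2_31 (q : R) :
    treeGF (fun t => if TreeCoder t then wt2_31 (-1) q t else 0) = 1 - X * (rescale q
      (treeGF (fun t => if TreeCoder t then wt2_31 (-1) q t else 0)) *
      (treeGF (wt2_31 (-1) q) - 1)) := by
  -- The right subtree is only required to be nonempty, since no letter after the maximum is a
  -- left-to-right maximum; so it carries the weight over all words.
  conv_lhs => rw [treeGF_of_node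
    (α := fun t => q ^ t.numNodes * (if TreeCoder t then wt2_31 (-1) q t else 0))
    (β := fun t => -1 * ((nodeInd t : R) * wt2_31 (-1) q t)) (by
      rintro l (_ | ⟨_, a, b⟩)
      · simp [TreeCoder]
      · by_cases hl : TreeCoder l
        · simp [wt2_31, treeDes, tree2_31, TreeCoder, hl]; ring
        · simp [TreeCoder, hl])]
  rw [treeGF_pow_numNodes_mul, treeGF_const_mul, treeGF_nodeInd_mul]
  simp [wt2_31, treeDes, tree2_31, TreeCoder]
  ring

theorem treeGF_coder_31_2 (q : R) :
    treeGF (fun t => if TreeCoder t then wt31_2 (-q) 1 q t else 0) = 1 - X * C q *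
      (treeGF (fun t => if TreeCoder t then wt31_2 (-q) 1 q t else 0) *
      (treeGF (wt31_2 (-q) q q) - 1)) := by
  conv_lhs => rw [treeGF_of_node
    (α := fun t => if TreeCoder t then wt31_2 (-q) 1 q t else 0)
    (β := fun t => -q * ((nodeInd t : R) * wt31_2 (-q) q q t)) (by
      rintro l (_ | ⟨_, a, b⟩)
      · simp [TreeCoder]
      · by_cases hl : TreeCoder l
        · simp [wt31_2, treeDes, tree31_2, TreeCoder, hl]; ring
        · simp [TreeCoder, hl])]
  rw [treeGF_const_mul, treeGF_nodeInd_mul]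
  simp [wt31_2, treeDes, tree31_2, TreeCoder, treeAboveFirst]
  ring

theorem treeGF_altOdd_2_31 (q : R) :
    treeGF (fun t => if TreeAltOdd t then (-1) ^ (t.numNodes / 2) * q ^ tree2_31 t else 0) =
      X - X * (rescale q (treeGF (fun t => if TreeAltOdd t then
        (-1) ^ (t.numNodes / 2) * q ^ tree2_31 t else 0)) * (treeGF (fun t => if TreeAltOdd t then
        (-1) ^ (t.numNodes / 2) * q ^ tree2_31 t else 0))) := by
  set w : BinaryTree Unit → R :=
    fun t => if TreeAltOdd t then (-1) ^ (t.numNodes / 2) * q ^ tree2_31 t else 0 with hw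
  have key : ∀ l r, w (l △ r) = (1 - (nodeInd l : R)) * (1 - (nodeInd r : R)) +
      (q ^ l.numNodes * w l) * (-1 * w r) := by
    intro l r
    by_cases h : TreeAltOdd l ∧ TreeAltOdd r
    · obtain ⟨a, ha⟩ := h.1.odd
      obtain ⟨b, hb⟩ := h.2.odd
      -- Two odd subtrees and the root raise the sum of the half-sizes by exactly one, which
      -- accounts for the factor `-1` at each inner node.
      have h1 : (2 * a + 1 + (2 * b + 1) + 1) / 2 = a + b + 1 := by omega
      have h2 : (2 * a + 1) / 2 = a := by omega
      have h3 : (2 * b + 1) / 2 = b := by omega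
      have hr : nodeInd r = 1 := by
        cases r with
        | nil => exact h.2.elim
        | node => rfl
      simp only [hw, TreeAltOdd, h.1, h.2, and_self, or_true, if_true, numNodes, ha, hb, h1, h2,
        h3, tree2_31, hr]
      push_cast
      ring
    · have : w l * w r = 0 := by
        simp only [hw]
        split_ifs with h1 h2 <;> simp_all
      have h4 : (q ^ l.numNodes * w l) * (-1 * w r) = 0 := by
        linear_combination (-q ^ l.numNodes) * this
      rw [h4]
      have hT : TreeAltOdd (l △ r) ↔ l = nil ∧ r = nil := or_iff_left h
      simp only [hw, hT]
      cases l <;> cases r <;> simp [tree2_31]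
  conv_lhs => rw [treeGF_of_node_add key]
  rw [treeGF_nilInd, treeGF_pow_numNodes_mul, treeGF_const_mul]
  simp [hw, TreeAltOdd]
  ring

theorem treeGF_altEven_2_31 (q : R) :
    treeGF (fun t => if TreeAltEven t then (-1) ^ (t.numNodes / 2) * q ^ tree2_31 t else 0) =
      1 - X * (rescale q (treeGF (fun t => if TreeAltEven t then
        (-1) ^ (t.numNodes / 2) * q ^ tree2_31 t else 0)) * (treeGF (fun t => if TreeAltOdd t then
        (-1) ^ (t.numNodes / 2) * q ^ tree2_31 t else 0))) := by
  set v : BinaryTree Unit → R :=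
    fun t => if TreeAltEven t then (-1) ^ (t.numNodes / 2) * q ^ tree2_31 t else 0 with hv
  set w : BinaryTree Unit → R :=
    fun t => if TreeAltOdd t then (-1) ^ (t.numNodes / 2) * q ^ tree2_31 t else 0 with hw
  have key : ∀ l r, v (l △ r) = (q ^ l.numNodes * v l) * (-1 * w r) := by
    intro l r
    by_cases h : TreeAltEven l ∧ TreeAltOdd r
    · obtain ⟨a, ha⟩ := h.1.even
      obtain ⟨b, hb⟩ := h.2.odd
      have h1 : (a + a + (2 * b + 1) + 1) / 2 = a + b + 1 := by omega
      have h2 : (a + a) / 2 = a := by omega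
      have h3 : (2 * b + 1) / 2 = b := by omega
      have hr : nodeInd r = 1 := by
        cases r with
        | nil => exact h.2.elim
        | node => rfl
      simp only [hv, hw, TreeAltEven, h.1, h.2, and_self, if_true, numNodes, ha, hb, h1, h2,
        h3, tree2_31, hr]
      ring
    · rw [show v (l △ r) = 0 from if_neg h]
      rcases not_and_or.1 h with h | h <;> simp [hv, hw, h]
  conv_lhs => rw [treeGF_of_node key]
  rw [treeGF_pow_numNodes_mul, treeGF_const_mul]
  simp [hv, TreeAltEven, tree2_31]
  ring

theorem treeGF_coder_2_31_eq (q : R) :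
    treeGF (fun t => if TreeCoder t then wt2_31 (-1) q t else 0) =
      treeGF (fun t => if TreeAltEven t then (-1) ^ (t.numNodes / 2) * q ^ tree2_31 t else 0) := by
  have hA := treeGF_wt2_31 (-1) q
  have hD := treeGF_coder_2_31 q
  have hK := treeGF_altOdd_2_31 q
  have hH := treeGF_altEven_2_31 q
  set A := treeGF (wt2_31 (-1) q)
  set D := treeGF (fun t => if TreeCoder t then wt2_31 (-1) q t else 0)
  set K := treeGF (fun t => if TreeAltOdd t then (-1) ^ (t.numNodes / 2) * q ^ tree2_31 t else 0)
  set H := treeGF (fun t => if TreeAltEven t then (-1) ^ (t.numNodes / 2) * q ^ tree2_31 t else 0)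
  -- The terms linear in `A - 1` cancel because `y = -1`, which leaves the equation of the odd
  -- alternating words.
  have hAK : A - 1 = K := by
    refine sub_eq_zero.1 (eq_zero_of_eq_X_mul (q := q) (P := 1 - rescale q A)
      (Q := -K) ?_)
    simp only [map_neg, map_one, map_sub] at *
    linear_combination hA - hK
  rw [hAK] at hD
  refine sub_eq_zero.1 (eq_zero_of_eq_X_mul (q := q) (P := 0) (Q := -K) ?_)
  simp only [map_sub]
  linear_combination hD - hH

theorem treeGF_altOdd_31_2 (q : R) :
    treeGF (fun t => if TreeAltOdd t then
        (-q) ^ (t.numNodes / 2) * q ^ (tree31_2 t + treeAboveFirst t) else 0) =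
      X - X * C (q ^ 2) * (treeGF (fun t => if TreeAltOdd t then
        (-q) ^ (t.numNodes / 2) * q ^ (tree31_2 t + treeAboveFirst t) else 0)) ^ 2 := by
  set w : BinaryTree Unit → R := fun t => if TreeAltOdd t then
    (-q) ^ (t.numNodes / 2) * q ^ (tree31_2 t + treeAboveFirst t) else 0 with hw
  have key : ∀ l r, w (l △ r) = (1 - (nodeInd l : R)) * (1 - (nodeInd r : R)) +
      w l * (-q ^ 2 * w r) := by
    intro l r
    by_cases h : TreeAltOdd l ∧ TreeAltOdd r
    · obtain ⟨a, ha⟩ := h.1.odd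
      obtain ⟨b, hb⟩ := h.2.odd
      have h1 : (2 * a + 1 + (2 * b + 1) + 1) / 2 = a + b + 1 := by omega
      have h2 : (2 * a + 1) / 2 = a := by omega
      have h3 : (2 * b + 1) / 2 = b := by omega
      have hr : nodeInd r = 1 := by
        cases r with
        | nil => exact h.2.elim
        | node => rfl
      have hl : nodeInd l = 1 := by
        cases l with
        | nil => exact h.1.elim
        | node => rfl
      simp only [hw, TreeAltOdd, h.1, h.2, and_self, or_true, if_true, numNodes, ha, hb, h1, h2,
        h3, tree31_2, treeAboveFirst, hr, hl]
      push_cast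
      ring
    · have : w l * w r = 0 := by
        simp only [hw]
        split_ifs with h1 h2 <;> simp_all
      have h4 : w l * (-q ^ 2 * w r) = 0 := by
        linear_combination (-q ^ 2) * this
      rw [h4]
      have hT : TreeAltOdd (l △ r) ↔ l = nil ∧ r = nil := or_iff_left h
      simp only [hw, hT]
      cases l <;> cases r <;> simp [tree31_2, treeAboveFirst]
  conv_lhs => rw [treeGF_of_node_add key]
  rw [treeGF_nilInd, treeGF_const_mul]
  simp [hw, TreeAltOdd]
  ring

theorem treeGF_altEven_31_2 (q : R) :
    treeGF (fun t => if TreeAltEven t then (-q) ^ (t.numNodes / 2) * q ^ tree31_2 t else 0) =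
      1 - X * C q * (treeGF (fun t => if TreeAltEven t then
        (-q) ^ (t.numNodes / 2) * q ^ tree31_2 t else 0) * (treeGF (fun t => if TreeAltOdd t then
        (-q) ^ (t.numNodes / 2) * q ^ (tree31_2 t + treeAboveFirst t) else 0))) := by
  set v : BinaryTree Unit → R :=
    fun t => if TreeAltEven t then (-q) ^ (t.numNodes / 2) * q ^ tree31_2 t else 0 with hv
  set w : BinaryTree Unit → R := fun t => if TreeAltOdd t then
    (-q) ^ (t.numNodes / 2) * q ^ (tree31_2 t + treeAboveFirst t) else 0 with hw
  have key : ∀ l r, v (l △ r) = v l * (-q * w r) := by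
    intro l r
    by_cases h : TreeAltEven l ∧ TreeAltOdd r
    · obtain ⟨a, ha⟩ := h.1.even
      obtain ⟨b, hb⟩ := h.2.odd
      have h1 : (a + a + (2 * b + 1) + 1) / 2 = a + b + 1 := by omega
      have h2 : (a + a) / 2 = a := by omega
      have h3 : (2 * b + 1) / 2 = b := by omega
      simp only [hv, hw, TreeAltEven, h.1, h.2, and_self, if_true, numNodes, ha, hb, h1, h2,
        h3, tree31_2]
      ring
    · rw [show v (l △ r) = 0 from if_neg h]
      rcases not_and_or.1 h with h | h <;> simp [hv, hw, h]
  conv_lhs => rw [treeGF_of_node key]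
  rw [treeGF_const_mul]
  simp [hv, TreeAltEven, tree31_2]
  ring

theorem treeGF_coder_31_2_eq (q : R) :
    treeGF (fun t => if TreeCoder t then wt31_2 (-q) 1 q t else 0) =
      treeGF (fun t => if TreeAltEven t then (-q) ^ (t.numNodes / 2) * q ^ tree31_2 t else 0) := by
  have hN := treeGF_wt31_2 (-q) q q
  have hD := treeGF_coder_31_2 q
  have hK := treeGF_altOdd_31_2 q
  have hH := treeGF_altEven_31_2 q
  set N := treeGF (wt31_2 (-q) q q)
  set D := treeGF (fun t => if TreeCoder t then wt31_2 (-q) 1 q t else 0)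
  set K := treeGF (fun t => if TreeAltOdd t then
    (-q) ^ (t.numNodes / 2) * q ^ (tree31_2 t + treeAboveFirst t) else 0)
  set H := treeGF (fun t => if TreeAltEven t then (-q) ^ (t.numNodes / 2) * q ^ tree31_2 t else 0)
  -- With `y = -q` and `u = q` the product is `(1 + q(N-1))(1 - q(N-1))`, so the linear terms cancel
  -- here too.
  have hNK : N - 1 = K := by
    refine sub_eq_zero.1 (eq_zero_of_eq_X_mul (q := 0) (P := -C q ^ 2 * (N - 1 + K))
      (Q := 0) ?_)
    simp only [map_neg, map_pow] at *
    linear_combination hN - hK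
  rw [hNK] at hD
  refine sub_eq_zero.1 (eq_zero_of_eq_X_mul (q := 0) (P := -C q * K) (Q := 0) ?_)
  linear_combination hD - hH

/-! ### Reversed and complemented coderangements -/

theorem treeGF_revCoder (w : BinaryTree Unit → R) (hnil : w nil = 1) (h1 : w (nil △ nil) = 1) :
    treeGF (fun t => if TreeRevCoder t then w t else 0) =
      1 - X + (treeGF (fun t => (nodeInd t : R) * if TreeNoMinTop t then w t else 0)) := by
  have h := treeGF_of_node (w := fun t => if t = nil △ nil then (1 : R) else 0)
    (α := fun t => 1 - (nodeInd t : R)) (β := fun t => 1 - (nodeInd t : R)) (by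
      rintro (_ | ⟨_, c, d⟩) (_ | ⟨_, a, b⟩) <;> simp)
  rw [treeGF_nilInd] at h
  simp only [reduceCtorEq, if_false, map_zero, zero_add, mul_one] at h
  have h2 : treeGF (fun t => if t = nil then (1 : R) else 0) = 1 := by
    rw [← treeGF_nilInd]
    congr 1
    funext t
    cases t <;> simp
  rw [← h2, ← h, sub_eq_add_neg]
  have h3 : ∀ f : BinaryTree Unit → R, -treeGF f = treeGF (fun t => - f t) := by
    intro f; ext; simp
  rw [h3, ← treeGF_add, ← treeGF_add]
  congr 1
  funext t
  -- Among nonempty trees the two conditions differ only at the single node, which is the term `-X`;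
  -- the empty tree gives the `1`.
  rcases t with _ | ⟨_, l, _ | ⟨_, a, b⟩⟩
  · simp [TreeRevCoder, hnil]
  · by_cases hl : l = nil
    · subst hl
      simp [TreeRevCoder, TreeNoMinTop, h1]
    · simp [TreeRevCoder, TreeNoMinTop, hl]
  · simp [TreeRevCoder, TreeNoMinTop]

theorem treeGF_revCoder_2_13 (q : R) :
    treeGF (fun t => if TreeRevCoder t then wt2_13 1 q t else 0) =
      1 - X ^ 2 * signedCarlitz q := by
  rw [treeGF_revCoder _ (by simp [wt2_13, treeDes, tree2_13, treeAboveLast])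
    (by simp [wt2_13, treeDes, tree2_13, treeAboveLast])]
  have hB := mul_eq_signedCarlitz (treeGF_wt2_13 q q)
  set B := treeGF (wt2_13 q q) with hBdef
  set F := signedCarlitz q
  set w : BinaryTree Unit → R :=
    fun t => (nodeInd t : R) * if TreeNoMinTop t then wt2_13 1 q t else 0 with hw
  have key : ∀ l r, w (l △ r) = (1 - (nodeInd l : R)) * (1 - (nodeInd r : R)) +
      wt2_13 q q l * (-1 * w r) := by
    rintro l (_ | ⟨_, a, b⟩)
    · cases l <;> simp [hw, TreeNoMinTop, wt2_13, treeDes, tree2_13, treeAboveLast]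
    · by_cases h : TreeNoMinTop (a △ b)
      · simp [hw, wt2_13, treeDes, tree2_13, h, TreeNoMinTop.eq_2 _ l]
        ring
      · simp [hw, h, TreeNoMinTop.eq_2 _ l]
  have hW := treeGF_of_node_add key
  rw [treeGF_nilInd, treeGF_const_mul, ← hBdef] at hW
  rw [show w nil = 0 by simp [hw], map_zero, map_neg, map_one] at hW
  set W := treeGF w
  -- `W = X (1 - BW)` and `1 + XB = 1 / (1 - XF)` give `W = X (1 - XF)`.
  linear_combination (1 - X * F) * hW - X * W * hB

theorem treeGF_revCoder_2_31 (q : R) :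
    treeGF (fun t => if TreeRevCoder t then wt2_31 (-q) q t else 0) =
      1 - C q * X ^ 2 * rescale q (signedCarlitz q) := by
  rw [treeGF_revCoder _ (by simp [wt2_31, treeDes, tree2_31])
    (by simp [wt2_31, treeDes, tree2_31])]
  -- At `y = -q` the `2-31` equation coincides with that of the `2-13` series at `u = q`.
  have hB := mul_eq_signedCarlitz (q := q) (B := treeGF (wt2_31 (-q) q))
    (by conv_lhs => rw [treeGF_wt2_31]
        rw [map_neg]; ring)
  replace hB := congrArg (rescale q) hB
  simp only [map_mul, map_sub, map_one, rescale_X] at hB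
  set B := treeGF (wt2_31 (-q) q) with hBdef
  set F := rescale q (signedCarlitz q)
  set w : BinaryTree Unit → R :=
    fun t => (nodeInd t : R) * if TreeNoMinTop t then wt2_31 (-q) q t else 0 with hw
  have key : ∀ l r, w (l △ r) = (1 - (nodeInd l : R)) * (1 - (nodeInd r : R)) +
      (q ^ l.numNodes * wt2_31 (-q) q l) * (-q * w r) := by
    rintro l (_ | ⟨_, a, b⟩)
    · cases l <;> simp [hw, TreeNoMinTop, wt2_31, treeDes, tree2_31]
    · by_cases h : TreeNoMinTop (a △ b)
      · simp [hw, wt2_31, treeDes, tree2_31, h, TreeNoMinTop.eq_2 _ l]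
        ring
      · simp [hw, h, TreeNoMinTop.eq_2 _ l]
  have hW := treeGF_of_node_add key
  rw [treeGF_nilInd, treeGF_const_mul, treeGF_pow_numNodes_mul, ← hBdef] at hW
  rw [show w nil = 0 by simp [hw], map_zero, map_neg] at hW
  set W := treeGF w
  linear_combination (1 - C q * X * F) * hW - X * C q * W * hB

end Series

/-! ### `132`-avoiding words and binary trees -/

section Words

/-- The `132`-avoiding word on the letters `k, k + 1, …, k + |t| - 1` encoded by a tree. -/
def word : BinaryTree Unit → ℕ → List ℕ
  | .nil, _ => []
  | .node _ l r, k => word l (k + r.numNodes) ++ (k + l.numNodes + r.numNodes) :: word r k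

@[simp] theorem word_nil (k : ℕ) : word nil k = [] := rfl

theorem word_node (v : Unit) (l r : BinaryTree Unit) (k : ℕ) : word (node v l r) k =
    word l (k + r.numNodes) ++ (k + l.numNodes + r.numNodes) :: word r k := rfl

@[simp]
theorem length_word (t : BinaryTree Unit) : ∀ k, (word t k).length = t.numNodes := by
  induction t with
  | nil => simp
  | node v l r hl hr => intro k; simp [word_node, hl, hr, add_assoc]

@[simp]
theorem word_eq_nil {t : BinaryTree Unit} {k : ℕ} : word t k = [] ↔ t = nil := by
  cases t <;> simp [word_node]

theorem mem_word {t : BinaryTree Unit} {x : ℕ} :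
    ∀ {k}, x ∈ word t k ↔ k ≤ x ∧ x < k + t.numNodes := by
  induction t with
  | nil => intro k; simp
  | node v l r hl hr =>
    intro k
    simp only [word_node, List.mem_append, List.mem_cons, hl, hr, numNodes]
    omega

theorem nodup_word (t : BinaryTree Unit) : ∀ k, (word t k).Nodup := by
  induction t with
  | nil => simp
  | node v l r hl hr =>
    intro k
    rw [word_node, List.nodup_append]
    refine ⟨hl _, List.nodup_cons.2 ⟨?_, hr _⟩, ?_⟩
    · rw [mem_word]; omega
    · intro a ha b hb
      rw [List.mem_cons, mem_word] at hb
      rw [mem_word] at ha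
      omega

theorem word_injective (t : BinaryTree Unit) :
    ∀ (t' : BinaryTree Unit) (k : ℕ), word t k = word t' k → t = t' := by
  induction t with
  | nil =>
    intro t' k h
    exact (word_eq_nil.1 h.symm).symm
  | node v l r hl hr =>
    intro t' k h
    cases t' with
    | nil => exact word_eq_nil.1 h
    | node v' l' r' =>
      have hlen := congrArg List.length h
      simp only [length_word, numNodes] at hlen
      rw [word_node, word_node, show k + l.numNodes + r.numNodes = k + l'.numNodes + r'.numNodes by
        -- The largest letter occurs only once in each word, so the two factorizations agree.
        omega, List.append_cons_inj_of_notMem (by rw [mem_word]; omega)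
          (by rw [mem_word]; omega)] at h
      obtain ⟨h1, -, h3⟩ := h
      have hr' := hr _ _ h3
      rw [hr'] at h1 ⊢
      rw [hl _ _ h1]

/-- No subsequence of the list is order-isomorphic to `132`. -/
def Avoids132 (l : List ℕ) : Prop := l.Triplewise fun a b c => ¬ (a < c ∧ c < b)

theorem avoids132_word (t : BinaryTree Unit) : ∀ k, Avoids132 (word t k) := by
  induction t with
  | nil => intro k; exact List.Triplewise.nil
  | node v l r hl hr =>
    intro k
    rw [word_node, Avoids132, List.triplewise_append, List.triplewise_cons]
    refine ⟨hl _, ⟨?_, hr _⟩, ?_, ?_⟩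
    · refine List.pairwise_of_forall_mem_list fun a ha b hb => ?_
      rw [mem_word] at ha hb
      omega
    · intro a ha
      refine List.pairwise_cons.2 ⟨fun b hb => ?_, List.pairwise_of_forall_mem_list
        fun b hb c hc => ?_⟩ <;> simp only [mem_word] at * <;> omega
    · intro a ha
      refine List.pairwise_of_forall_mem_list fun b hb c hc => ?_
      simp only [mem_word, List.mem_cons] at *
      omega

theorem length_eq_of_mem_iff {l : List ℕ} {k n : ℕ} (hl : l.Nodup)
    (hmem : ∀ x, x ∈ l ↔ k ≤ x ∧ x < k + n) : l.length = n := by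
  have : l.toFinset = Finset.Ico k (k + n) := by ext x; simp [hmem]
  rw [← List.toFinset_card_of_nodup hl, this]
  simp

/-- Induction on the length, cutting at the largest letter. With that letter in the role of `3`,
avoidance puts every earlier letter above every later one, so both sides fill intervals of values.
-/
theorem exists_word_eq (n : ℕ) : ∀ (k : ℕ) (l : List ℕ), l.Nodup →
    (∀ x, x ∈ l ↔ k ≤ x ∧ x < k + n) → Avoids132 l → ∃ t, t.numNodes = n ∧ word t k = l := by
  induction n using Nat.strong_induction_on with
  | _ n ih =>
    intro k l hnd hmem hav
    have hlen := length_eq_of_mem_iff hnd hmem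
    cases n with
    | zero => exact ⟨nil, rfl, (List.length_eq_zero_iff.1 hlen).symm⟩
    | succ n =>
      obtain ⟨s, r, rfl⟩ := List.append_of_mem ((hmem (k + n)).2 (by omega))
      rw [List.nodup_append, List.nodup_cons] at hnd
      obtain ⟨hs, ⟨hmr, hr⟩, hsr⟩ := hnd
      rw [Avoids132, List.triplewise_append, List.triplewise_cons] at hav
      obtain ⟨avs, ⟨-, avr⟩, hav, -⟩ := hav
      have hne : ∀ x, x ∈ s → x ≠ k + n := fun x hx => hsr x hx _ List.mem_cons_self
      have hgt : ∀ x ∈ s, ∀ y ∈ r, y < x := by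
        intro x hx y hy
        have h1 := (List.pairwise_cons.1 (hav x hx)).1 y hy
        have h2 := hsr x hx y (List.mem_cons_of_mem _ hy)
        have h3 := (hmem y).1 (by simp [hy])
        have h4 : y ≠ k + n := fun h => hmr (h ▸ hy)
        omega
      simp only [List.length_append, List.length_cons] at hlen
      simp only [List.mem_append, List.mem_cons] at hmem
      have hrmem : r.toFinset = Finset.Ico k (k + r.length) := by
        refine Finset.eq_of_subset_of_card_le (fun x hx => ?_) ?_
        · rw [List.mem_toFinset] at hx
          have hx' := (hmem x).1 (Or.inr (Or.inr hx))
          have hx2 : x ≠ k + n := fun h => hmr (h ▸ hx)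
          -- The letters after the maximum are closed downwards, so counting those up to `x` bounds
          -- `x`.
          have hsub : Finset.Ico k (x + 1) ⊆ r.toFinset := by
            intro y hy
            rw [Finset.mem_Ico] at hy
            rcases (hmem y).2 (by omega) with h | h | h
            · have := hgt y h x hx
              omega
            · omega
            · exact List.mem_toFinset.2 h
          have hcard := Finset.card_le_card hsub
          rw [List.toFinset_card_of_nodup hr, Nat.card_Ico] at hcard
          rw [Finset.mem_Ico]
          omega
        · rw [List.toFinset_card_of_nodup hr]
          simp
      have hrmem' : ∀ x, x ∈ r ↔ k ≤ x ∧ x < k + r.length := fun x => by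
        rw [← List.mem_toFinset, hrmem, Finset.mem_Ico]
      have hsmem : ∀ x, x ∈ s ↔ k + r.length ≤ x ∧ x < k + r.length + s.length := by
        intro x
        have h1 := hmem x
        have h2 := hrmem' x
        constructor
        · intro hx
          have h3 := hne x hx
          have h4 : x ∉ r := fun h => hsr x hx x (List.mem_cons_of_mem _ h) rfl
          have := h1.1 (Or.inl hx)
          rw [h2] at h4
          omega
        · intro hx
          rcases h1.2 (by omega) with h | h | h
          · exact h
          · omega
          · have := h2.1 h
            omega
      obtain ⟨tr, htr, hwr⟩ := ih r.length (by omega) k r hr hrmem' avr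
      obtain ⟨ts, hts, hws⟩ := ih s.length (by omega) (k + r.length) s hs hsmem avs
      refine ⟨ts △ tr, by simp only [numNodes]; omega, ?_⟩
      rw [word_node, htr, hts, hwr, hws, show k + s.length + r.length = k + n by omega]

end Words

/-! ### Permutations as words -/

section PermWord

variable {n : ℕ}

/-- The one-line notation of a permutation. -/
def permWord (π : Equiv.Perm (Fin n)) : List ℕ := List.ofFn fun i => (π i : ℕ)

theorem permWord_injective : Function.Injective (permWord (n := n)) := by
  intro π σ h
  have h' := List.ofFn_injective h
  ext i
  exact congrFun h' i

theorem nodup_permWord (π : Equiv.Perm (Fin n)) : (permWord π).Nodup :=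
  List.nodup_ofFn.2 (Fin.val_injective.comp π.injective)

theorem mem_permWord (π : Equiv.Perm (Fin n)) (x : ℕ) : x ∈ permWord π ↔ x < n := by
  rw [permWord, List.mem_ofFn]
  exact ⟨fun ⟨i, hi⟩ => hi ▸ (π i).isLt, fun h => ⟨π.symm ⟨x, h⟩, by simp⟩⟩

theorem exists_permWord_eq {l : List ℕ} (hl : l.Nodup) (hmem : ∀ x, x ∈ l ↔ x < n) :
    ∃ π : Equiv.Perm (Fin n), permWord π = l := by
  have hlen : l.length = n := length_eq_of_mem_iff (k := 0) hl (by simpa using hmem)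
  subst hlen
  refine ⟨Equiv.ofBijective (fun i => ⟨l[i], (hmem _).1 (List.getElem_mem _)⟩)
    (Finite.injective_iff_bijective.1 fun i j h => ?_), ?_⟩
  · exact Fin.ext ((List.Nodup.getElem_inj_iff hl).1 (Fin.mk.inj h))
  · simp [permWord]

theorem avoids_132_iff (π : Equiv.Perm (Fin n)) :
    Avoids ![1, 3, 2] π ↔ Avoids132 (permWord π) := by
  rw [Avoids132, List.triplewise_iff_getElem, Avoids]
  constructor
  · intro h i j k hij hjk hk hlt
    simp only [permWord, List.length_ofFn] at hk
    simp only [permWord, List.getElem_ofFn, Fin.val_fin_lt] at hlt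
    refine h ⟨![⟨i, by omega⟩, ⟨j, by omega⟩, ⟨k, hk⟩], ?_, ?_⟩
    · intro a b hab
      fin_cases a <;> fin_cases b <;> simp at hab ⊢ <;> omega
    · have h1 := hlt.1.trans hlt.2
      intro a b
      fin_cases a <;> fin_cases b <;> simp [hlt.1, hlt.2, h1, hlt.1.le, hlt.2.le, h1.le]
  · rintro h ⟨f, hf, hp⟩
    have h1 := (hp 0 2).2 (by simp)
    have h2 := (hp 2 1).2 (by simp)
    refine h (f 0) (f 1) (f 2) (hf 0 1 (by simp)) (hf 1 2 (by simp)) (by simp [permWord]) ?_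
    simpa [permWord] using ⟨h1, h2⟩

theorem sum_avoiding_132 {R : Type*} [CommRing R] (f : Equiv.Perm (Fin n) → R)
    (g : BinaryTree Unit → R) (h : ∀ π t, permWord π = word t 0 → f π = g t) :
    ∑ π ∈ avoiding n ![1, 3, 2], f π = ∑ t ∈ treesOfNumNodesEq n, g t := by
  have hex : ∀ t ∈ treesOfNumNodesEq n, ∃ π : Equiv.Perm (Fin n), permWord π = word t 0 := by
    intro t ht
    refine exists_permWord_eq (nodup_word _ _) fun x => ?_
    rw [mem_word, mem_treesOfNumNodesEq.1 ht]
    simp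
  choose! F hF using hex
  symm
  refine Finset.sum_bij (fun t _ => F t) ?_ ?_ ?_ ?_
  · intro t ht
    simp only [avoiding, Finset.mem_filter, Finset.mem_univ, true_and]
    rw [avoids_132_iff, hF t ht]
    exact avoids132_word t 0
  · intro t ht t' ht' heq
    exact word_injective _ _ 0 (by rw [← hF t ht, ← hF t' ht', heq])
  · intro π hπ
    simp only [avoiding, Finset.mem_filter, Finset.mem_univ, true_and] at hπ
    obtain ⟨t, ht, htw⟩ := exists_word_eq n 0 (permWord π) (nodup_permWord π)
      (by simpa using mem_permWord π) ((avoids_132_iff π).1 hπ)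
    have ht' := mem_treesOfNumNodesEq.2 ht
    exact ⟨t, ht', permWord_injective (by rw [hF t ht', htw])⟩
  · intro t ht
    exact (h _ _ (hF t ht)).symm

end PermWord

/-! ### Statistics on lists -/

section ListStats

/-- The sum of `w x y` over the pairs `x, y` of consecutive letters. -/
def adjSum (w : ℕ → ℕ → ℕ) : List ℕ → ℕ
  | [] => 0
  | [_] => 0
  | x :: y :: l => w x y + adjSum w (y :: l)

/-- The sum of `w x y a` over the pairs `x, y` of consecutive letters and the letters `a` to their
left. -/
def beforeSum (w : ℕ → ℕ → ℕ → ℕ) : List ℕ → ℕ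
  | [] => 0
  | a :: l => adjSum (fun x y => w x y a) l + beforeSum w l

/-- The sum of `w x y a` over the pairs `x, y` of consecutive letters and the letters `a` to their
right. -/
def afterSum (w : ℕ → ℕ → ℕ → ℕ) : List ℕ → ℕ
  | [] => 0
  | [_] => 0
  | x :: y :: l => (l.map (w x y)).sum + afterSum w (y :: l)

/-- The number of letters exceeding `c`. -/
def aboveVal (c : ℕ) (l : List ℕ) : ℕ := (l.map fun a => if c < a then 1 else 0).sum

/-- The number of letters exceeding the last one. -/
def aboveLast (l : List ℕ) : ℕ := aboveVal (l.getLast?.getD 0) l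

/-- The number of letters exceeding the first one. -/
def aboveFirst (l : List ℕ) : ℕ := aboveVal (l.head?.getD 0) l

/-- Descent indicator. -/
def descInd (x y : ℕ) : ℕ := if y < x then 1 else 0

/-- Indicator of a descent `x, y` with the value `a` in between. -/
def descOver (x y a : ℕ) : ℕ := if y < a ∧ a < x then 1 else 0

/-- Indicator of an ascent `x, y` with the value `a` in between. -/
def ascOver (x y a : ℕ) : ℕ := if x < a ∧ a < y then 1 else 0

theorem adjSum_append_cons (w : ℕ → ℕ → ℕ) (m : ℕ) (r : List ℕ) :
    ∀ s, adjSum w (s ++ m :: r) = adjSum w (s ++ [m]) + adjSum w (m :: r)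
  | [] => by simp [adjSum]
  | [x] => by simp [adjSum]
  | x :: y :: s => by
    have := adjSum_append_cons w m r (y :: s)
    simp only [List.cons_append, adjSum] at this ⊢
    omega

theorem adjSum_concat {w : ℕ → ℕ → ℕ} {m : ℕ} :
    ∀ s : List ℕ, (∀ x ∈ s, w x m = 0) → adjSum w (s ++ [m]) = adjSum w s
  | [], _ => by simp [adjSum]
  | [x], h => by simp [adjSum, h x]
  | x :: y :: s, h => by
    have := adjSum_concat (y :: s) fun x hx => h x (List.mem_cons_of_mem _ hx)
    simp only [List.cons_append, adjSum] at this ⊢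
    omega

theorem adjSum_congr {v w : ℕ → ℕ → ℕ} :
    ∀ l : List ℕ, (∀ x ∈ l, ∀ y ∈ l, v x y = w x y) → adjSum v l = adjSum w l
  | [], _ => rfl
  | [_], _ => rfl
  | x :: y :: l, h => by
    rw [adjSum, adjSum, h x (by simp) y (by simp),
      adjSum_congr (y :: l) fun a ha b hb => h a (by simp [ha]) b (by simp [hb])]

theorem adjSum_zero : ∀ l : List ℕ, adjSum (fun _ _ => 0) l = 0
  | [] => rfl
  | [_] => rfl
  | _ :: y :: l => by rw [adjSum, adjSum_zero (y :: l)]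

theorem adjSum_eq_zero {w : ℕ → ℕ → ℕ} {l : List ℕ} (h : ∀ x ∈ l, ∀ y ∈ l, w x y = 0) :
    adjSum w l = 0 := by
  rw [adjSum_congr l h, adjSum_zero]

theorem adjSum_cons_tree {w : ℕ → ℕ → ℕ} {m c k : ℕ} {r : BinaryTree Unit}
    (h : ∀ y ∈ word r k, w m y = c) :
    adjSum w (m :: word r k) = c * nodeInd r + adjSum w (word r k) := by
  cases hr : word r k with
  | nil =>
    rw [word_eq_nil] at hr
    simp [hr, adjSum]
  | cons y l =>
    rw [adjSum, h y (by simp [hr])]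
    cases r with
    | nil => simp at hr
    | node => simp

/-- The four terms sort the occurrences by the free letter `a`: before `m` (with the pair up to `m`,
or from `m` on), equal to `m`, or after `m`. -/
theorem beforeSum_append_cons (w : ℕ → ℕ → ℕ → ℕ) (m : ℕ) (r : List ℕ) :
    ∀ s, beforeSum w (s ++ m :: r) = beforeSum w (s ++ [m]) +
      (s.map fun a => adjSum (fun x y => w x y a) (m :: r)).sum +
      adjSum (fun x y => w x y m) r + beforeSum w r
  | [] => by simp [beforeSum, adjSum]
  | a :: s => by
    have h1 := beforeSum_append_cons w m r s
    have h2 := adjSum_append_cons (fun x y => w x y a) m r s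
    simp only [List.cons_append, beforeSum, List.map_cons, List.sum_cons]
    omega

theorem beforeSum_concat {w : ℕ → ℕ → ℕ → ℕ} {m : ℕ} :
    ∀ s : List ℕ, (∀ x ∈ s, ∀ a ∈ s, w x m a = 0) → beforeSum w (s ++ [m]) = beforeSum w s
  | [], _ => by simp [beforeSum, adjSum]
  | a :: s, h => by
    rw [List.cons_append, beforeSum, beforeSum,
      beforeSum_concat s fun x hx a ha => h x (by simp [hx]) a (by simp [ha]),
      adjSum_concat (w := fun x y => w x y a) s fun x hx => h x (by simp [hx]) a (by simp)]

theorem beforeSum_concat_concat (w : ℕ → ℕ → ℕ → ℕ) (z m : ℕ) :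
    ∀ s, beforeSum w (s ++ [z] ++ [m]) = beforeSum w (s ++ [z]) + (s.map fun a => w z m a).sum
  | [] => by simp [beforeSum, adjSum]
  | a :: s => by
    have h1 := beforeSum_concat_concat w z m s
    have h2 := adjSum_append_cons (fun x y => w x y a) z [m] s
    simp only [List.append_assoc, List.cons_append, List.nil_append, beforeSum, List.map_cons,
      List.sum_cons, adjSum] at h1 h2 ⊢
    omega

/-- The hypotheses exclude every occurrence whose consecutive pair begins in `s` and whose free
letter is `m` or lies in `r`. -/
theorem afterSum_append_cons {w : ℕ → ℕ → ℕ → ℕ} {m : ℕ} {r : List ℕ} :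
    ∀ s : List ℕ, (∀ x ∈ s, ∀ y ∈ s, ∀ a, (a = m ∨ a ∈ r) → w x y a = 0) →
      (∀ x ∈ s, ∀ a ∈ r, w x m a = 0) →
      afterSum w (s ++ m :: r) = afterSum w s + afterSum w (m :: r)
  | [], _, _ => by simp [afterSum]
  | [x], _, h => by
    have : (r.map (w x m)).sum = 0 := List.sum_eq_zero fun c hc => by
      obtain ⟨a, ha, rfl⟩ := List.mem_map.1 hc
      exact h x (by simp) a ha
    simp [afterSum, this]
  | x :: y :: s, h1, h2 => by
    have ih := afterSum_append_cons (w := w) (m := m) (r := r) (y :: s)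
      (fun a ha b hb => h1 a (by simp [ha]) b (by simp [hb]))
      (fun a ha => h2 a (by simp [ha]))
    have : (r.map (w x y)).sum = 0 := List.sum_eq_zero fun c hc => by
      obtain ⟨a, ha, rfl⟩ := List.mem_map.1 hc
      exact h1 x (by simp) y (by simp) a (Or.inr ha)
    simp only [List.cons_append, afterSum, List.map_append, List.map_cons, List.sum_append,
      List.sum_cons, this, h1 x (by simp) y (by simp) m (Or.inl rfl)] at ih ⊢
    omega

theorem sum_map_eq_length {l : List ℕ} {f : ℕ → ℕ} {c : ℕ} (h : ∀ a ∈ l, f a = c) :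
    (l.map f).sum = c * l.length := by
  rw [List.map_congr_left h]
  simp [mul_comm]

theorem aboveVal_append_cons (c m : ℕ) (s r : List ℕ) : aboveVal c (s ++ m :: r) =
    aboveVal c s + ((if c < m then 1 else 0) + aboveVal c r) := by
  simp [aboveVal]

theorem aboveVal_eq_zero {c : ℕ} {l : List ℕ} (h : ∀ a ∈ l, a ≤ c) : aboveVal c l = 0 := by
  rw [aboveVal, sum_map_eq_length (c := 0) fun a ha => if_neg (h a ha).not_gt, zero_mul]

theorem aboveVal_eq_length {c : ℕ} {l : List ℕ} (h : ∀ a ∈ l, c < a) :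
    aboveVal c l = l.length := by
  rw [aboveVal, sum_map_eq_length (c := 1) fun a ha => if_pos (h a ha), one_mul]

theorem nodeInd_eq_one {t : BinaryTree Unit} (h : t ≠ nil) : nodeInd t = 1 := by
  cases t with
  | nil => exact absurd rfl h
  | node => rfl

theorem aboveLast_word (t : BinaryTree Unit) : ∀ k, aboveLast (word t k) = treeAboveLast t := by
  induction t with
  | nil => intro k; rfl
  | node v l r hl hr =>
    intro k
    rw [aboveLast, word_node, treeAboveLast]
    rcases eq_or_ne r nil with rfl | hne
    · rw [word_nil, List.getLast?_append, List.getLast?_singleton, nodeInd_nil, zero_mul]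
      refine aboveVal_eq_zero fun a ha => ?_
      simp [mem_word] at ha ⊢
      omega
    · have hne' : word r k ≠ [] := by simpa using hne
      have hlast : (word l (k + r.numNodes) ++ (k + l.numNodes + r.numNodes) ::
          word r k).getLast? = (word r k).getLast? := by
        obtain ⟨y, r', hy⟩ := List.exists_cons_of_ne_nil hne'
        rw [hy, List.getLast?_append, List.getLast?_cons_cons]
        simp [List.getLast?_cons]
      have hz : (word r k).getLast?.getD 0 < k + r.numNodes := by
        rw [List.getLast?_eq_getLast_of_ne_nil hne']
        exact (mem_word.1 (List.getLast_mem hne')).2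
      rw [hlast, aboveVal_append_cons, ← aboveLast, hr, nodeInd_eq_one hne, if_pos (by omega),
        aboveVal_eq_length, length_word]
      · ring
      · intro a ha
        rw [mem_word] at ha
        omega

theorem aboveFirst_word (t : BinaryTree Unit) : ∀ k, aboveFirst (word t k) = treeAboveFirst t := by
  induction t with
  | nil => intro k; rfl
  | node v l r hl hr =>
    intro k
    rw [aboveFirst, word_node, treeAboveFirst]
    rcases eq_or_ne l nil with rfl | hne
    · rw [word_nil, List.nil_append, List.head?_cons, nodeInd_nil, zero_mul]
      refine aboveVal_eq_zero fun a ha => ?_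
      simp [mem_word] at ha ⊢
      omega
    · have hne' : word l (k + r.numNodes) ≠ [] := by simpa using hne
      have hhead : (word l (k + r.numNodes) ++ (k + l.numNodes + r.numNodes) ::
          word r k).head? = (word l (k + r.numNodes)).head? := by
        obtain ⟨y, r', hy⟩ := List.exists_cons_of_ne_nil hne'
        rw [hy]
        rfl
      have hz : k + r.numNodes ≤ (word l (k + r.numNodes)).head?.getD 0 ∧
          (word l (k + r.numNodes)).head?.getD 0 < k + r.numNodes + l.numNodes := by
        rw [List.head?_eq_some_head hne']
        exact mem_word.1 (List.head_mem hne')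
      rw [hhead, aboveVal_append_cons, ← aboveFirst, hl, nodeInd_eq_one hne, if_pos (by omega),
        aboveVal_eq_zero]
      · ring
      · intro a ha
        rw [mem_word] at ha
        omega

theorem adjSum_descInd_word (t : BinaryTree Unit) :
    ∀ k, adjSum descInd (word t k) = treeDes t := by
  induction t with
  | nil => intro k; rfl
  | node v l r hl hr =>
    intro k
    rw [word_node, adjSum_append_cons, adjSum_concat, hl, adjSum_cons_tree (c := 1), hr, treeDes]
    · ring
    · intro y hy
      rw [mem_word] at hy
      exact if_pos (by omega)
    · intro x hx
      rw [mem_word] at hx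
      exact if_neg (by omega)

/-- Left letters exceed both ends of any pair inside the right word, and the step into the root is
no descent. Only the descent out of the root is new, and all left letters lie between its ends. -/
theorem beforeSum_descOver_word (t : BinaryTree Unit) :
    ∀ k, beforeSum descOver (word t k) = tree2_31 t := by
  induction t with
  | nil => intro k; rfl
  | node v l r hl hr =>
    intro k
    rw [word_node, beforeSum_append_cons, beforeSum_concat, hl, hr, adjSum_eq_zero,
      sum_map_eq_length (c := nodeInd r), tree2_31, length_word]
    · ring
    · intro a ha
      rw [mem_word] at ha
      rw [adjSum_cons_tree (c := 1), adjSum_eq_zero]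
      · ring
      · intro x hx y hy
        rw [mem_word] at hx
        exact if_neg (by omega)
      · intro y hy
        rw [mem_word] at hy
        exact if_pos (by omega)
    · intro x hx y hy
      rw [mem_word] at hx
      exact if_neg (by omega)
    · intro x hx a ha
      rw [mem_word] at hx ha
      exact if_neg (by omega)

/-- The only new consecutive pair is the last letter of `s` followed by `m`; as `m` is the maximum,
the letters between them in value are those above the last one. -/
theorem beforeSum_ascOver_concat {s : List ℕ} {m : ℕ} (hm : ∀ x ∈ s, x < m) :
    beforeSum ascOver (s ++ [m]) = beforeSum ascOver s + aboveLast s := by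
  rcases List.eq_nil_or_concat s with rfl | ⟨s, z, rfl⟩
  · simp [beforeSum, adjSum, aboveLast, aboveVal]
  · rw [List.concat_eq_append] at *
    rw [beforeSum_concat_concat, aboveLast, List.getLast?_append, List.getLast?_singleton,
      Option.some_or, Option.getD_some, aboveVal_append_cons, if_neg (lt_irrefl z), aboveVal,
      aboveVal, List.map_nil, List.sum_nil]
    congr 2
    refine List.map_congr_left fun a ha => ?_
    simp [ascOver, hm a (by simp [ha])]

theorem beforeSum_ascOver_word (t : BinaryTree Unit) :
    ∀ k, beforeSum ascOver (word t k) = tree2_13 t := by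
  induction t with
  | nil => intro k; rfl
  | node v l r hl hr =>
    intro k
    rw [word_node, beforeSum_append_cons, beforeSum_ascOver_concat, hl, hr, adjSum_eq_zero,
      sum_map_eq_length (c := 0), aboveLast_word, tree2_13]
    · ring
    · intro a ha
      rw [mem_word] at ha
      rw [adjSum_cons_tree (c := 0), adjSum_eq_zero]
      · ring
      · intro x hx y hy
        rw [mem_word] at hy
        exact if_neg (by omega)
      · intro y hy
        exact if_neg (by omega)
    · intro x hx y hy
      rw [mem_word] at hy
      exact if_neg (by omega)
    · intro x hx
      rw [mem_word] at hx
      omega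

theorem afterSum_descOver_cons {r : List ℕ} {m : ℕ} (hm : ∀ x ∈ r, x < m) :
    afterSum descOver (m :: r) = aboveFirst r + afterSum descOver r := by
  cases r with
  | nil => simp [afterSum, aboveFirst, aboveVal]
  | cons y r =>
    rw [afterSum, aboveFirst, aboveVal, List.head?_cons, Option.getD_some, List.map_cons,
      List.sum_cons, if_neg (lt_irrefl y), zero_add]
    congr 2
    refine List.map_congr_left fun a ha => ?_
    simp [descOver, hm a (by simp [ha])]

theorem afterSum_descOver_word (t : BinaryTree Unit) :
    ∀ k, afterSum descOver (word t k) = tree31_2 t := by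
  induction t with
  | nil => intro k; rfl
  | node v l r hl hr =>
    intro k
    rw [word_node, afterSum_append_cons, afterSum_descOver_cons, hl, hr, aboveFirst_word, tree31_2]
    · ring
    · intro x hx
      rw [mem_word] at hx
      omega
    · intro x hx y hy a ha
      rw [mem_word] at hx hy ha
      exact if_neg (by omega)
    · intro x hx a ha
      rw [mem_word] at hx ha
      exact if_neg (by omega)

end ListStats

/-! ### Coderangements and alternating words -/

section ListPredicates

/-- The marked letter `a` lies before, at or after the cut `m`. -/
theorem append_cons_eq_append_cons_iff {α : Type*} {m a : α} {r r' : List α} :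
    ∀ {s s' : List α}, s ++ m :: r = s' ++ a :: r' ↔
      (∃ u, s = s' ++ a :: u ∧ r' = u ++ m :: r) ∨ (s = s' ∧ m = a ∧ r = r') ∨
        ∃ u, s' = s ++ m :: u ∧ r = u ++ a :: r'
  | [], [] => by simp
  | [], y :: s' => by simp; grind
  | x :: s, [] => by simp; grind
  | x :: s, y :: s' => by
    have := append_cons_eq_append_cons_iff (m := m) (a := a) (r := r) (r' := r') (s := s) (s' := s')
    simp only [List.cons_append, List.cons.injEq, this]
    grind

/-- No left-to-right maximum is an ascent bottom, the last letter counting as an ascent bottom. -/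
def ListCoder (l : List ℕ) : Prop :=
  ∀ s a r, l = s ++ a :: r → (∀ x ∈ s, x ≤ a) → ∃ b r', r = b :: r' ∧ b < a

/-- No right-to-left minimum is an ascent top, the first letter counting as an ascent top. -/
def ListRevCoder (l : List ℕ) : Prop :=
  ∀ s a r, l = s ++ a :: r → (∀ x ∈ r, a ≤ x) → ∃ s' b, s = s' ++ [b] ∧ a < b

/-- No right-to-left minimum is an ascent top, the first letter not counting as an ascent top. -/
def ListNoMinTop (l : List ℕ) : Prop :=
  ∀ s b a r, l = s ++ b :: a :: r → (∀ x ∈ r, a ≤ x) → a < b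

/-- Letters after `m` are never left-to-right maxima, while `m` is one and must be followed by a
descent. The last letter of `s` steps up to `m`, which matches the convention that a last letter
counts as an ascent bottom. -/
theorem listCoder_append_cons {s r : List ℕ} {m : ℕ} (hs : ∀ x ∈ s, x < m)
    (hr : ∀ x ∈ r, x < m) : ListCoder (s ++ m :: r) ↔ ListCoder s ∧ r ≠ [] := by
  constructor
  · intro h
    refine ⟨fun s1 a s2 hs12 hmax => ?_, fun hr0 => ?_⟩
    · subst hs12
      obtain ⟨b, r', h1, h2⟩ := h s1 a (s2 ++ m :: r) (by simp) hmax
      cases s2 with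
      | nil =>
        have := hs a (by simp)
        simp only [List.nil_append, List.cons.injEq] at h1
        omega
      | cons y s2 =>
        simp only [List.cons_append, List.cons.injEq] at h1
        exact ⟨y, s2, rfl, h1.1 ▸ h2⟩
    · obtain ⟨b, r', h1, -⟩ := h s m r rfl fun x hx => (hs x hx).le
      simp [hr0] at h1
  · rintro ⟨h, hr0⟩ s1 a r1 heq hmax
    rcases append_cons_eq_append_cons_iff.1 heq with ⟨u, rfl, rfl⟩ | ⟨rfl, rfl, rfl⟩ | ⟨u, rfl, rfl⟩
    · obtain ⟨b, r', rfl, h2⟩ := h s1 a u rfl hmax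
      exact ⟨b, r' ++ m :: r, by simp, h2⟩
    · obtain ⟨b, r', rfl⟩ := List.exists_cons_of_ne_nil hr0
      exact ⟨b, r', rfl, hr b (by simp)⟩
    · have h1 := hmax m (by simp)
      have h2 := hr a (by simp)
      omega

theorem listCoder_word (t : BinaryTree Unit) : ∀ k, ListCoder (word t k) ↔ TreeCoder t := by
  induction t with
  | nil => simp [ListCoder, TreeCoder]
  | node v l r hl hr =>
    intro k
    rw [word_node, listCoder_append_cons, hl, TreeCoder, Ne, word_eq_nil]
    all_goals
      intro x hx
      rw [mem_word] at hx
      omega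

/-- If the right word is nonempty, all right-to-left minima lie in it, and its first letter follows
the larger root. If it is empty, the root is itself such a minimum and an ascent top, unless the
left word is empty too. -/
theorem listNoMinTop_word (t : BinaryTree Unit) :
    ∀ k, ListNoMinTop (word t k) ↔ TreeNoMinTop t := by
  induction t with
  | nil => simp [ListNoMinTop, TreeNoMinTop]
  | node v l r hl hr =>
    intro k
    rw [TreeNoMinTop, ← hr k, word_node]
    constructor
    · intro h
      constructor
      · rintro rfl
        by_contra hne
        rcases List.eq_nil_or_concat (word l (k + 0)) with h0 | ⟨s, z, hz⟩
        · exact hne (word_eq_nil.1 h0)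
        · have hz' : z ∈ word l (k + 0) := by rw [hz]; simp
          have h1 := h s z (k + l.numNodes + 0) [] (by simp at hz ⊢; simp [hz]) (by simp)
          rw [mem_word] at hz'
          omega
      · intro s b a r' heq hmin
        exact h (word l (k + r.numNodes) ++ (k + l.numNodes + r.numNodes) :: s) b a r'
          (by simp [heq]) hmin
    · rintro ⟨h1, h2⟩ s b a r' heq hmin
      have hmem : ∀ x, x ∈ word r k → x < k + r.numNodes := fun x hx => (mem_word.1 hx).2
      have hmeml : ∀ x, x ∈ word l (k + r.numNodes) → k + r.numNodes ≤ x :=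
        fun x hx => (mem_word.1 hx).1
      rcases append_cons_eq_append_cons_iff.1 heq with ⟨u, hu1, hu2⟩ | ⟨-, rfl, hu⟩ | ⟨u, -, hu⟩
      · have hr0 : r ≠ nil := fun h0 => by
          rw [word_eq_nil.2 (h1 h0)] at hu1
          simp at hu1
        obtain ⟨y, r'', hy⟩ := List.exists_cons_of_ne_nil (mt word_eq_nil.1 hr0 : word r k ≠ [])
        exfalso
        cases u with
        | nil =>
          simp only [List.nil_append, List.cons.injEq] at hu2
          have := hmin y (by rw [hu2.2, hy]; simp)
          have := hmem y (by simp [hy])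
          omega
        | cons z u =>
          simp only [List.cons_append, List.cons.injEq] at hu2
          have := hmin y (by rw [hu2.2, hy]; simp)
          have := hmem y (by simp [hy])
          have := hmeml a (by rw [hu1, hu2.1]; simp)
          omega
      · have := hmem a (by simp [hu])
        omega
      · exact h2 u b a r' hu hmin

theorem listRevCoder_word (t : BinaryTree Unit) (k : ℕ) :
    ListRevCoder (word t k) ↔ TreeRevCoder t := by
  cases t with
  | nil => simp [ListRevCoder, TreeRevCoder]
  | node v l r =>
    rw [TreeRevCoder, ← listNoMinTop_word r k, word_node]
    have hmem : ∀ x, x ∈ word r k → x < k + r.numNodes := fun x hx => (mem_word.1 hx).2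
    have hmeml : ∀ x, x ∈ word l (k + r.numNodes) →
        k + r.numNodes ≤ x ∧ x < k + r.numNodes + l.numNodes := fun x hx => mem_word.1 hx
    constructor
    · intro h
      constructor
      · rintro rfl
        obtain ⟨s', b, h1, h2⟩ := h _ _ _ rfl (by simp)
        have := hmeml b (by rw [h1]; simp)
        simp at this
        omega
      · intro s b a r' heq hmin
        obtain ⟨s', b', h1, h2⟩ := h (word l (k + r.numNodes) ++
          (k + l.numNodes + r.numNodes) :: s ++ [b]) a r' (by simp [heq]) hmin
        have := List.append_inj_right' h1 rfl
        simp only [List.cons.injEq, and_true] at this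
        omega
    · rintro ⟨h1, h2⟩ s a r' heq hmin
      obtain ⟨y, r'', hy⟩ := List.exists_cons_of_ne_nil (mt word_eq_nil.1 h1 : word r k ≠ [])
      have hyk := hmem y (by simp [hy])
      rcases append_cons_eq_append_cons_iff.1 heq with ⟨u, hu1, hu2⟩ | ⟨-, rfl, hu⟩ | ⟨u, hu1, hu⟩
      · have := hmin y (by simp [hu2, hy])
        have := hmeml a (by simp [hu1])
        omega
      · have := hmin y (by simp [← hu, hy])
        omega
      · have ha := hmem a (by simp [hu])
        rcases List.eq_nil_or_concat u with rfl | ⟨u, z, rfl⟩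
        · exact ⟨_, _, hu1, by omega⟩
        · rw [List.concat_eq_append] at *
          exact ⟨word l (k + r.numNodes) ++ (k + l.numNodes + r.numNodes) :: u, z, by simp [hu1],
            h2 u z a r' (by simp [hu]) hmin⟩

/-- Alternation of ascents and descents, starting with an ascent if `b` is true. -/
def AltFrom : Bool → List ℕ → Prop
  | _, [] => True
  | _, [_] => True
  | b, x :: y :: l => (if b then x < y else y < x) ∧ AltFrom (!b) (y :: l)

/-- The step into the maximum must be an ascent, which fixes the parity of the length of a nonempty
`s`. -/
theorem altFrom_append_cons {m : ℕ} {r : List ℕ} : ∀ {s : List ℕ} {b : Bool},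
    (∀ x ∈ s, x < m) → (AltFrom b (s ++ m :: r) ↔ AltFrom b s ∧
      (s ≠ [] → s.length.bodd = b) ∧ AltFrom (b ^^ s.length.bodd) (m :: r))
  | [], b, _ => by simp [AltFrom]
  | [x], b, h => by
    have hx := h x (by simp)
    cases b <;> simp [AltFrom, hx, hx.le]
  | x :: y :: s, b, h => by
    have := altFrom_append_cons (m := m) (r := r) (s := y :: s) (b := !b)
      fun a ha => h a (by simp [ha])
    simp only [List.cons_append, AltFrom] at this ⊢
    rw [this]
    simp only [List.length_cons, Nat.bodd_succ, ne_eq, reduceCtorEq, not_false_eq_true,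
      forall_const]
    cases b <;> cases s.length.bodd <;> simp [and_assoc]

theorem altFrom_cons {m : ℕ} {r : List ℕ} {b : Bool} (h : ∀ x ∈ r, x < m) :
    AltFrom b (m :: r) ↔ (r ≠ [] → b = false) ∧ AltFrom (!b) r := by
  cases r with
  | nil => simp [AltFrom]
  | cons y r =>
    have hy := h y (by simp)
    cases b <;> simp [AltFrom, hy, hy.le]

theorem altFrom_word (t : BinaryTree Unit) : ∀ k,
    (TreeAltEven t ↔ t.numNodes.bodd = false ∧ AltFrom false (word t k)) ∧
    (TreeAltOdd t ↔ t.numNodes.bodd = true ∧ AltFrom true (word t k)) := by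
  induction t with
  | nil => simp [TreeAltEven, TreeAltOdd, AltFrom]
  | node v l r hl hr =>
    intro k
    have hm1 : ∀ x ∈ word l (k + r.numNodes), x < k + l.numNodes + r.numNodes := fun x hx => by
      rw [mem_word] at hx; omega
    have hm2 : ∀ x ∈ word r k, x < k + l.numNodes + r.numNodes := fun x hx => by
      rw [mem_word] at hx; omega
    simp only [word_node, altFrom_append_cons hm1, altFrom_cons hm2, TreeAltEven, TreeAltOdd,
      (hl (k + r.numNodes)).1, (hl (k + r.numNodes)).2, (hr k).2, numNodes, Nat.bodd_succ,
      Nat.bodd_add, length_word, ne_eq, word_eq_nil]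
    rcases eq_or_ne l nil with rfl | hl0 <;> rcases eq_or_ne r nil with rfl | hr0
    · simp [AltFrom]
    · cases r.numNodes.bodd <;> simp [AltFrom, hr0]
    · cases l.numNodes.bodd <;> simp [AltFrom, hl0]
    · cases l.numNodes.bodd <;> cases r.numNodes.bodd <;> simp [hl0, hr0]

end ListPredicates

/-! ### Reversal and complementation of lists -/

section ListSymmetry

theorem adjSum_map (w : ℕ → ℕ → ℕ) (f : ℕ → ℕ) :
    ∀ l, adjSum w (l.map f) = adjSum (fun x y => w (f x) (f y)) l
  | [] => rfl
  | [_] => rfl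
  | x :: y :: l => by
    have := adjSum_map w f (y :: l)
    simp only [List.map_cons, adjSum] at this ⊢
    rw [this]

theorem beforeSum_map (w : ℕ → ℕ → ℕ → ℕ) (f : ℕ → ℕ) :
    ∀ l, beforeSum w (l.map f) = beforeSum (fun x y a => w (f x) (f y) (f a)) l
  | [] => rfl
  | a :: l => by rw [List.map_cons, beforeSum, beforeSum, beforeSum_map w f l, adjSum_map]

theorem afterSum_map (w : ℕ → ℕ → ℕ → ℕ) (f : ℕ → ℕ) :
    ∀ l, afterSum w (l.map f) = afterSum (fun x y a => w (f x) (f y) (f a)) l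
  | [] => rfl
  | [_] => rfl
  | x :: y :: l => by
    have := afterSum_map w f (y :: l)
    simp only [List.map_cons, afterSum, List.map_map] at this ⊢
    rw [this]
    rfl

theorem beforeSum_congr {v w : ℕ → ℕ → ℕ → ℕ} : ∀ l : List ℕ,
    (∀ x ∈ l, ∀ y ∈ l, ∀ a ∈ l, v x y a = w x y a) → beforeSum v l = beforeSum w l
  | [], _ => rfl
  | a :: l, h => by
    rw [beforeSum, beforeSum, beforeSum_congr l fun x hx y hy a ha =>
      h x (by simp [hx]) y (by simp [hy]) a (by simp [ha]),
      adjSum_congr (w := fun x y => w x y a) l fun x hx y hy =>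
        h x (by simp [hx]) y (by simp [hy]) a (by simp)]

theorem adjSum_reverse (w : ℕ → ℕ → ℕ) :
    ∀ l, adjSum w l.reverse = adjSum (fun x y => w y x) l
  | [] => rfl
  | [_] => rfl
  | x :: y :: l => by
    have := adjSum_reverse w (y :: l)
    have h := adjSum_append_cons w y [x] l.reverse
    simp only [List.reverse_cons, List.append_assoc, List.cons_append, List.nil_append,
      adjSum] at this h ⊢
    omega

theorem afterSum_concat (w : ℕ → ℕ → ℕ → ℕ) (a : ℕ) :
    ∀ l, afterSum w (l ++ [a]) = afterSum w l + adjSum (fun x y => w x y a) l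
  | [] => rfl
  | [_] => rfl
  | x :: y :: l => by
    have := afterSum_concat w a (y :: l)
    simp only [List.cons_append, afterSum, adjSum, List.map_append, List.map_cons, List.map_nil,
      List.sum_append, List.sum_cons, List.sum_nil] at this ⊢
    omega

theorem afterSum_reverse (w : ℕ → ℕ → ℕ → ℕ) :
    ∀ l, afterSum w l.reverse = beforeSum (fun x y a => w y x a) l
  | [] => rfl
  | a :: l => by
    rw [List.reverse_cons, afterSum_concat, afterSum_reverse w l, adjSum_reverse, beforeSum,
      add_comm]

theorem beforeSum_reverse (w : ℕ → ℕ → ℕ → ℕ) (l : List ℕ) :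
    beforeSum w l.reverse = afterSum (fun x y a => w y x a) l := by
  have := afterSum_reverse (fun x y a => w y x a) l.reverse
  rw [List.reverse_reverse] at this
  exact this.symm

theorem altFrom_iff_getElem : ∀ {l : List ℕ} {b : Bool}, AltFrom b l ↔
    ∀ (i : ℕ) (h : i + 1 < l.length), if i.bodd = !b then l[i] < l[i + 1] else l[i + 1] < l[i]
  | [], b => by simp [AltFrom]
  | [x], b => by simp [AltFrom]
  | x :: y :: l, b => by
    rw [AltFrom, altFrom_iff_getElem]
    constructor
    · rintro ⟨h1, h2⟩ i hi
      cases i with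
      | zero => cases b <;> simpa using h1
      | succ i =>
        have := h2 i (by simpa using hi)
        rw [Nat.bodd_succ]
        cases b <;> cases hb : i.bodd <;> simpa [hb] using this
    · intro h
      constructor
      · have := h 0 (by simp)
        cases b <;> simpa using this
      · intro i hi
        have := h (i + 1) (by simpa using hi)
        rw [Nat.bodd_succ] at this
        cases b <;> cases hb : i.bodd <;> simpa [hb] using this

theorem AltFrom.reverse {l : List ℕ} {b : Bool} (hl : l.length.bodd = false) (h : AltFrom b l) :
    AltFrom (!b) l.reverse := by
  rw [altFrom_iff_getElem] at h ⊢
  intro i hi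
  rw [List.length_reverse] at hi
  -- Step `i` of the reversed list is step `j` read backwards; for even length `i` and `j` have the
  -- same parity.
  obtain ⟨j, hj⟩ : ∃ j, l.length = j + i + 2 := ⟨l.length - i - 2, by omega⟩
  have hb : j.bodd = i.bodd := by
    rw [hj, Nat.bodd_succ, Nat.bodd_succ, Nat.bodd_add, Bool.not_not] at hl
    cases h1 : j.bodd <;> cases h2 : i.bodd <;> simp_all
  have h1 : l.reverse[i] = l[j + 1] := by
    rw [List.getElem_reverse]
    congr 1
    omega
  have h2 : l.reverse[i + 1] = l[j] := by
    rw [List.getElem_reverse]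
    congr 1
    omega
  have := h j (by omega)
  rw [h1, h2]
  rw [hb] at this
  cases b <;> cases hi : i.bodd <;> simpa [hi] using this

theorem altFrom_reverse {l : List ℕ} {b : Bool} (hl : l.length.bodd = false) :
    AltFrom b l.reverse ↔ AltFrom (!b) l := by
  constructor
  · intro h
    simpa using h.reverse (by simpa using hl)
  · intro h
    simpa using h.reverse hl

/-- Reverse-complementation turns left-to-right maxima at ascent bottoms into right-to-left minima
at ascent tops; the convention on the last letter becomes the one on the first. -/
theorem listCoder_reverse_map {n : ℕ} {l : List ℕ} (hl : ∀ x ∈ l, x < n) :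
    ListCoder (l.reverse.map (n - 1 - ·)) ↔ ListRevCoder l := by
  constructor
  · rintro h s a r rfl hmin
    obtain ⟨b, r', h1, h2⟩ := h (r.reverse.map (n - 1 - ·)) (n - 1 - a)
      (s.reverse.map (n - 1 - ·)) (by simp) (by
        intro x hx
        obtain ⟨y, hy, rfl⟩ := List.mem_map.1 hx
        have := hmin y (List.mem_reverse.1 hy)
        omega)
    rcases List.eq_nil_or_concat s with rfl | ⟨s, z, rfl⟩
    · simp at h1
    · refine ⟨s, z, by simp, ?_⟩
      rw [List.concat_eq_append, List.reverse_append, List.reverse_singleton,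
        List.singleton_append, List.map_cons, List.cons.injEq] at h1
      have := hl z (by simp)
      omega
  · intro h s a r heq hmax
    -- Truncated subtraction from `n - 1` is an involution only on letters below `n`, hence the
    -- bound `hl`.
    have hinv : (l.reverse.map (n - 1 - ·)).reverse.map (n - 1 - ·) = l := by
      rw [← List.map_reverse, List.reverse_reverse, List.map_map]
      conv_rhs => rw [← List.map_id l]
      refine List.map_congr_left fun x hx => ?_
      have := hl x hx
      simp only [Function.comp_apply, id]
      omega
    rw [heq] at hinv
    obtain ⟨s', b, h1, h2⟩ := h (r.reverse.map (n - 1 - ·)) (n - 1 - a)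
      (s.reverse.map (n - 1 - ·)) (by simp [← hinv]) (by
        intro x hx
        obtain ⟨y, hy, rfl⟩ := List.mem_map.1 hx
        have := hmax y (List.mem_reverse.1 hy)
        omega)
    cases r with
    | nil => simp at h1
    | cons y r =>
      refine ⟨y, r, rfl, ?_⟩
      rw [List.reverse_cons, List.map_append, List.map_singleton] at h1
      have := List.append_inj_right' h1 rfl
      simp only [List.cons.injEq, and_true] at this
      omega

theorem adjSum_descInd_add (l : List ℕ) (hl : l.Nodup) :
    adjSum descInd l + adjSum (fun x y => descInd y x) l = l.length - 1 := by
  induction l with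
  | nil => rfl
  | cons x l ih =>
    cases l with
    | nil => rfl
    | cons y l =>
      have h1 := ih (List.nodup_cons.1 hl).2
      have h2 : descInd x y + descInd y x = 1 := by
        have : x ≠ y := fun h => (List.nodup_cons.1 hl).1 (by simp [h])
        unfold descInd
        split_ifs <;> omega
      simp only [adjSum, List.length_cons] at h1 ⊢
      omega

end ListSymmetry

/-! ### Statistics of permutations -/

section PermStats

theorem adjSum_ofFn (w : ℕ → ℕ → ℕ) : ∀ (n : ℕ) (f : Fin n → ℕ),
    adjSum w (List.ofFn f) =
      ∑ i : Fin n, if h : i.val + 1 < n then w (f i) (f ⟨i.val + 1, h⟩) else 0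
  | 0, f => by simp [adjSum]
  | 1, f => by simp [adjSum]
  | n + 2, f => by
    have ih := adjSum_ofFn w (n + 1) fun i => f i.succ
    rw [List.ofFn_succ, Fin.sum_univ_succ]
    rw [List.ofFn_succ] at ih ⊢
    rw [adjSum, ih]
    congr 1
    simp

theorem beforeSum_ofFn (w : ℕ → ℕ → ℕ → ℕ) : ∀ (n : ℕ) (f : Fin n → ℕ),
    beforeSum w (List.ofFn f) = ∑ j : Fin n, ∑ i : Fin n, if j < i then
      (if h : i.val + 1 < n then w (f i) (f ⟨i.val + 1, h⟩) (f j) else 0) else 0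
  | 0, f => by simp [beforeSum]
  | n + 1, f => by
    have hdite : ∀ (j : Fin (n + 1)) (i : Fin n),
        (if h : i.succ.val + 1 < n + 1 then w (f i.succ) (f ⟨i.succ.val + 1, h⟩) (f j) else 0) =
        if h : i.val + 1 < n then w (f i.succ) (f (Fin.succ ⟨i.val + 1, h⟩)) (f j) else 0 := by
      intro j i
      by_cases h : i.val + 1 < n
      · rw [dif_pos h, dif_pos (by simpa using h)]
        rfl
      · rw [dif_neg h, dif_neg (by simpa using h)]
    rw [List.ofFn_succ, beforeSum, Fin.sum_univ_succ]
    simp only [Fin.sum_univ_succ (f := fun i : Fin (n + 1) => if _ < i then _ else _), hdite,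
      lt_irrefl, if_false, Fin.not_lt_zero, zero_add, Fin.succ_pos, if_true,
      Fin.succ_lt_succ_iff]
    rw [beforeSum_ofFn w n, adjSum_ofFn]

theorem afterSum_ofFn (w : ℕ → ℕ → ℕ → ℕ) : ∀ (n : ℕ) (f : Fin n → ℕ),
    afterSum w (List.ofFn f) = ∑ i : Fin n, ∑ j : Fin n, if i.val + 1 < j.val then
      (if h : i.val + 1 < n then w (f i) (f ⟨i.val + 1, h⟩) (f j) else 0) else 0
  | 0, f => by simp [afterSum]
  | 1, f => by simp [afterSum]
  | n + 2, f => by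
    have ih := afterSum_ofFn w (n + 1) fun i => f i.succ
    rw [List.ofFn_succ, Fin.sum_univ_succ]
    rw [List.ofFn_succ] at ih ⊢
    rw [afterSum, ih]
    congr 1
    · rw [Fin.sum_univ_succ, Fin.sum_univ_succ, List.map_ofFn, List.sum_ofFn]
      simp
    · refine Finset.sum_congr rfl fun i _ => ?_
      rw [Fin.sum_univ_succ (n := n + 1), if_neg (by simp), zero_add]
      refine Finset.sum_congr rfl fun j _ => ?_
      by_cases h : i.val + 1 < n + 1
      · rw [dif_pos h, dif_pos (by simpa using h)]
        simp
      · rw [dif_neg h, dif_neg (by simpa using h)]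
        simp

variable {n : ℕ} (π : Equiv.Perm (Fin n))

theorem des_eq_adjSum : des π = adjSum descInd (permWord π) := by
  rw [permWord, adjSum_ofFn, des, Finset.card_filter]
  refine Finset.sum_congr rfl fun i _ => ?_
  by_cases h : i.val + 1 < n <;> simp [h, descInd]

theorem vinc2_31_eq_beforeSum : vinc2_31 π = beforeSum descOver (permWord π) := by
  rw [permWord, beforeSum_ofFn, vinc2_31, Finset.card_filter, Fintype.sum_prod_type,
    Finset.sum_comm]
  refine Finset.sum_congr rfl fun j _ => Finset.sum_congr rfl fun i _ => ?_
  by_cases h : i.val + 1 < n <;> by_cases h' : j < i <;> simp [h, h', descOver]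

theorem vinc2_13_eq_beforeSum : vinc2_13 π = beforeSum ascOver (permWord π) := by
  rw [permWord, beforeSum_ofFn, vinc2_13, Finset.card_filter, Fintype.sum_prod_type,
    Finset.sum_comm]
  refine Finset.sum_congr rfl fun j _ => Finset.sum_congr rfl fun i _ => ?_
  by_cases h : i.val + 1 < n <;> by_cases h' : j < i <;> simp [h, h', ascOver]

theorem vinc31_2_eq_afterSum : vinc31_2 π = afterSum descOver (permWord π) := by
  rw [permWord, afterSum_ofFn, vinc31_2, Finset.card_filter, Fintype.sum_prod_type]
  refine Finset.sum_congr rfl fun i _ => Finset.sum_congr rfl fun j _ => ?_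
  by_cases h : i.val + 1 < n <;> by_cases h' : i.val + 1 < j.val <;> simp [h, h', descOver]

theorem vinc13_2_eq_afterSum : vinc13_2 π = afterSum ascOver (permWord π) := by
  rw [permWord, afterSum_ofFn, vinc13_2, Finset.card_filter, Fintype.sum_prod_type]
  refine Finset.sum_congr rfl fun i _ => Finset.sum_congr rfl fun j _ => ?_
  by_cases h : i.val + 1 < n <;> by_cases h' : i.val + 1 < j.val <;> simp [h, h', ascOver]

theorem even_iff_bodd {i : ℕ} : Even i ↔ i.bodd = false := by
  rw [Nat.even_iff, Nat.mod_two_of_bodd]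
  cases i.bodd <;> simp

theorem isAlternating_iff_altFrom : IsAlternating π ↔ AltFrom true (permWord π) := by
  rw [altFrom_iff_getElem, IsAlternating]
  constructor
  · intro h i hi
    rw [permWord, List.length_ofFn] at hi
    simpa [permWord, even_iff_bodd] using h ⟨i, by omega⟩ hi
  · intro h i hi
    simpa [permWord, even_iff_bodd] using h i (by simpa [permWord] using hi)

theorem listCoder_iff_getElem {l : List ℕ} : ListCoder l ↔ ∀ (i : ℕ) (h : i < l.length),
    (∀ (j : ℕ) (hj : j ≤ i), l[j] ≤ l[i]) → ∃ h' : i + 1 < l.length, l[i + 1] < l[i] := by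
  constructor
  · intro h i hi hmax
    obtain ⟨b, r', h1, h2⟩ := h (l.take i) l[i] (l.drop (i + 1))
      (by rw [← List.drop_eq_getElem_cons, List.take_append_drop]) (by
        intro x hx
        obtain ⟨j, hj, rfl⟩ := List.mem_take_iff_getElem.1 hx
        exact hmax j (by omega))
    have hlen : i + 1 < l.length := by
      by_contra hle
      rw [List.drop_eq_nil_of_le (by omega)] at h1
      simp at h1
    rw [List.drop_eq_getElem_cons hlen, List.cons.injEq] at h1
    exact ⟨hlen, h1.1 ▸ h2⟩
  · rintro h s a r rfl hmax
    obtain ⟨h1, h2⟩ := h s.length (by simp) (by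
      intro j hj
      rcases hj.lt_or_eq with hj | rfl
      · simpa [List.getElem_append_left hj] using hmax _ (List.getElem_mem hj)
      · rfl)
    cases r with
    | nil => simp at h1
    | cons b r => exact ⟨b, r, rfl, by simpa using h2⟩

theorem fmax_eq_zero_iff : fmax π = 0 ↔ ListCoder (permWord π) := by
  rw [listCoder_iff_getElem, fmax, Finset.card_eq_zero, Finset.filter_eq_empty_iff]
  constructor
  · intro h i hi hmax
    have hi' : i < n := by simpa [permWord] using hi
    have h1 := h (Finset.mem_univ ⟨i, hi'⟩)
    rw [not_and] at h1
    have h2 := h1 fun j hj => by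
      simpa [permWord] using hmax j hj
    push Not at h2
    obtain ⟨h3, h4⟩ := h2
    refine ⟨by simpa [permWord] using h3, ?_⟩
    have h5 : π ⟨i + 1, h3⟩ ≠ π ⟨i, hi'⟩ := fun h => by
      have := Fin.mk.inj (π.injective h)
      omega
    simpa [permWord] using lt_of_le_of_ne h4 h5
  · rintro h i - ⟨h1, h2⟩
    obtain ⟨h3, h4⟩ := h i (by simp [permWord]) fun j hj => by
      simpa [permWord] using h1 ⟨j, by omega⟩ hj
    have h3' : i.val + 1 < n := by simpa [permWord] using h3
    have h5 := h2 h3'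
    simp only [permWord, List.getElem_ofFn, Fin.val_fin_lt] at h4
    exact absurd (h5.trans h4) (lt_irrefl _)

end PermStats

/-! ### Reversal and complementation of permutations -/

section PermSymmetry

variable {n : ℕ} (π : Equiv.Perm (Fin n))

theorem permWord_mul_rev : permWord (π * Fin.revPerm) = (permWord π).reverse := by
  refine List.ext_getElem (by simp [permWord]) fun i h1 h2 => ?_
  rw [List.getElem_reverse]
  simp only [permWord, List.getElem_ofFn, Equiv.Perm.mul_apply, Fin.revPerm_apply,
    List.length_ofFn]
  congr 2
  rw [Fin.ext_iff, Fin.val_rev]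
  simp only
  omega

theorem permWord_rev_mul : permWord (Fin.revPerm * π) = (permWord π).map (n - 1 - ·) := by
  rw [permWord, permWord, List.map_ofFn]
  congr 1
  funext i
  simp only [Equiv.Perm.mul_apply, Fin.revPerm_apply, Fin.val_rev, Function.comp_apply]
  omega

theorem avoids_mul_rev_iff {k : ℕ} (p : Fin k → ℕ) :
    Avoids p (π * Fin.revPerm) ↔ Avoids (p ∘ Fin.rev) π := by
  rw [Avoids, Avoids, not_iff_not]
  constructor
  · rintro ⟨f, hf, hp⟩
    exact ⟨fun a => (f a.rev).rev, fun a b hab => Fin.rev_lt_rev.2 (hf _ _ (Fin.rev_lt_rev.2 hab)),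
      fun a b => hp a.rev b.rev⟩
  · rintro ⟨f, hf, hp⟩
    refine ⟨fun a => (f a.rev).rev,
      fun a b hab => Fin.rev_lt_rev.2 (hf _ _ (Fin.rev_lt_rev.2 hab)), fun a b => ?_⟩
    simpa using hp a.rev b.rev

theorem avoids_rev_mul_iff {k : ℕ} {p p' : Fin k → ℕ} (h : ∀ a b, p' a < p' b ↔ p b < p a) :
    Avoids p (Fin.revPerm * π) ↔ Avoids p' π := by
  rw [Avoids, Avoids, not_iff_not]
  refine exists_congr fun f => and_congr_right fun _ => ?_
  simp only [Equiv.Perm.mul_apply, Fin.revPerm_apply, Fin.rev_lt_rev, h]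
  exact forall_comm

theorem avoids_231_mul_rev : Avoids ![2, 3, 1] (π * Fin.revPerm) ↔ Avoids ![1, 3, 2] π := by
  rw [avoids_mul_rev_iff, show (![2, 3, 1] ∘ Fin.rev : Fin 3 → ℕ) = ![1, 3, 2] by decide]

theorem avoids_312_rev_mul : Avoids ![3, 1, 2] (Fin.revPerm * π) ↔ Avoids ![1, 3, 2] π :=
  avoids_rev_mul_iff π (by decide)

theorem avoids_213_rev_mul_rev :
    Avoids ![2, 1, 3] (Fin.revPerm * (π * Fin.revPerm)) ↔ Avoids ![1, 3, 2] π := by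
  rw [avoids_rev_mul_iff (p' := ![2, 3, 1]) _ (by decide), avoids_231_mul_rev]

theorem sum_avoiding_of_equiv {R : Type*} [CommRing R] {p : Fin 3 → ℕ}
    (e : Equiv.Perm (Fin n) ≃ Equiv.Perm (Fin n))
    (he : ∀ π, Avoids p (e π) ↔ Avoids ![1, 3, 2] π) (f : Equiv.Perm (Fin n) → R)
    (g : BinaryTree Unit → R) (h : ∀ π t, permWord π = word t 0 → f (e π) = g t) :
    ∑ π ∈ avoiding n p, f π = ∑ t ∈ treesOfNumNodesEq n, g t := by
  rw [← sum_avoiding_132 (fun π => f (e π)) g h]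
  refine (Finset.sum_equiv e (fun π => ?_) fun _ _ => rfl).symm
  simp [avoiding, he]

theorem sum_avoiding_213 {R : Type*} [CommRing R] (f : Equiv.Perm (Fin n) → R)
    (g : BinaryTree Unit → R)
    (h : ∀ π t, permWord π = word t 0 → f (Fin.revPerm * (π * Fin.revPerm)) = g t) :
    ∑ π ∈ avoiding n ![2, 1, 3], f π = ∑ t ∈ treesOfNumNodesEq n, g t :=
  sum_avoiding_of_equiv ((Equiv.mulRight Fin.revPerm).trans (Equiv.mulLeft Fin.revPerm))
    avoids_213_rev_mul_rev f g h

theorem sum_avoiding_312 {R : Type*} [CommRing R] (f : Equiv.Perm (Fin n) → R)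
    (g : BinaryTree Unit → R) (h : ∀ π t, permWord π = word t 0 → f (Fin.revPerm * π) = g t) :
    ∑ π ∈ avoiding n ![3, 1, 2], f π = ∑ t ∈ treesOfNumNodesEq n, g t :=
  sum_avoiding_of_equiv (Equiv.mulLeft Fin.revPerm) avoids_312_rev_mul f g h

theorem sum_avoiding_231 {R : Type*} [CommRing R] (f : Equiv.Perm (Fin n) → R)
    (g : BinaryTree Unit → R) (h : ∀ π t, permWord π = word t 0 → f (π * Fin.revPerm) = g t) :
    ∑ π ∈ avoiding n ![2, 3, 1], f π = ∑ t ∈ treesOfNumNodesEq n, g t :=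
  sum_avoiding_of_equiv (Equiv.mulRight Fin.revPerm) avoids_231_mul_rev f g h

variable {π} {t : BinaryTree Unit}

theorem numNodes_of_permWord (h : permWord π = word t 0) : t.numNodes = n := by
  rw [← length_word t 0, ← h, permWord, List.length_ofFn]

theorem lt_of_mem_of_permWord (h : permWord π = word t 0) {x : ℕ} (hx : x ∈ word t 0) : x < n :=
  (mem_permWord π x).1 (h ▸ hx)

end PermSymmetry

/-! ### Statistics of a permutation and its symmetric images, read off the tree -/

section Transfer

variable {n : ℕ} {π : Equiv.Perm (Fin n)} {t : BinaryTree Unit}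

theorem des_of_permWord (h : permWord π = word t 0) : des π = treeDes t := by
  rw [des_eq_adjSum, h, adjSum_descInd_word]

theorem vinc2_31_of_permWord (h : permWord π = word t 0) : vinc2_31 π = tree2_31 t := by
  rw [vinc2_31_eq_beforeSum, h, beforeSum_descOver_word]

theorem vinc2_13_of_permWord (h : permWord π = word t 0) : vinc2_13 π = tree2_13 t := by
  rw [vinc2_13_eq_beforeSum, h, beforeSum_ascOver_word]

theorem vinc31_2_of_permWord (h : permWord π = word t 0) : vinc31_2 π = tree31_2 t := by
  rw [vinc31_2_eq_afterSum, h, afterSum_descOver_word]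

theorem fmax_of_permWord (h : permWord π = word t 0) : fmax π = 0 ↔ TreeCoder t := by
  rw [fmax_eq_zero_iff, h, listCoder_word]

theorem permWord_rev_mul_rev :
    permWord (Fin.revPerm * (π * Fin.revPerm)) = (permWord π).reverse.map (n - 1 - ·) := by
  rw [permWord_rev_mul, permWord_mul_rev]

theorem des_rev_mul_rev (h : permWord π = word t 0) :
    des (Fin.revPerm * (π * Fin.revPerm)) = treeDes t := by
  rw [des_eq_adjSum, permWord_rev_mul_rev, adjSum_map, adjSum_reverse, h,
    ← adjSum_descInd_word t 0]
  refine adjSum_congr _ fun x hx y hy => ?_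
  have := lt_of_mem_of_permWord h hx
  have := lt_of_mem_of_permWord h hy
  exact if_congr (by omega) rfl rfl

theorem vinc31_2_rev_mul_rev (h : permWord π = word t 0) :
    vinc31_2 (Fin.revPerm * (π * Fin.revPerm)) = tree2_31 t := by
  rw [vinc31_2_eq_afterSum, permWord_rev_mul_rev, afterSum_map, afterSum_reverse, h,
    ← beforeSum_descOver_word t 0]
  refine beforeSum_congr _ fun x hx y hy a ha => ?_
  have := lt_of_mem_of_permWord h hx
  have := lt_of_mem_of_permWord h hy
  have := lt_of_mem_of_permWord h ha
  exact if_congr (by omega) rfl rfl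

theorem vinc13_2_rev_mul_rev (h : permWord π = word t 0) :
    vinc13_2 (Fin.revPerm * (π * Fin.revPerm)) = tree2_13 t := by
  rw [vinc13_2_eq_afterSum, permWord_rev_mul_rev, afterSum_map, afterSum_reverse, h,
    ← beforeSum_ascOver_word t 0]
  refine beforeSum_congr _ fun x hx y hy a ha => ?_
  have := lt_of_mem_of_permWord h hx
  have := lt_of_mem_of_permWord h hy
  have := lt_of_mem_of_permWord h ha
  exact if_congr (by omega) rfl rfl

theorem fmax_rev_mul_rev (h : permWord π = word t 0) :
    fmax (Fin.revPerm * (π * Fin.revPerm)) = 0 ↔ TreeRevCoder t := by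
  rw [fmax_eq_zero_iff, permWord_rev_mul_rev, h,
    listCoder_reverse_map fun x hx => lt_of_mem_of_permWord h hx, listRevCoder_word]

theorem des_rev_mul_add (h : permWord π = word t 0) :
    des (Fin.revPerm * π) + treeDes t = n - 1 := by
  rw [des_eq_adjSum, permWord_rev_mul, adjSum_map, h, ← adjSum_descInd_word t 0, add_comm]
  conv_rhs => rw [← numNodes_of_permWord h, ← length_word t 0,
    ← adjSum_descInd_add _ (nodup_word t 0)]
  congr 1
  refine adjSum_congr _ fun x hx y hy => ?_
  have := lt_of_mem_of_permWord h hx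
  have := lt_of_mem_of_permWord h hy
  exact if_congr (by omega) rfl rfl

theorem vinc2_31_rev_mul (h : permWord π = word t 0) :
    vinc2_31 (Fin.revPerm * π) = tree2_13 t := by
  rw [vinc2_31_eq_beforeSum, permWord_rev_mul, beforeSum_map, h, ← beforeSum_ascOver_word t 0]
  refine beforeSum_congr _ fun x hx y hy a ha => ?_
  have := lt_of_mem_of_permWord h hx
  have := lt_of_mem_of_permWord h hy
  have := lt_of_mem_of_permWord h ha
  exact if_congr (by omega) rfl rfl

theorem vinc2_13_rev_mul (h : permWord π = word t 0) :
    vinc2_13 (Fin.revPerm * π) = tree2_31 t := by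
  rw [vinc2_13_eq_beforeSum, permWord_rev_mul, beforeSum_map, h, ← beforeSum_descOver_word t 0]
  refine beforeSum_congr _ fun x hx y hy a ha => ?_
  have := lt_of_mem_of_permWord h hx
  have := lt_of_mem_of_permWord h hy
  have := lt_of_mem_of_permWord h ha
  exact if_congr (by omega) rfl rfl

theorem vinc13_2_mul_rev (h : permWord π = word t 0) :
    vinc13_2 (π * Fin.revPerm) = tree2_31 t := by
  rw [vinc13_2_eq_afterSum, permWord_mul_rev, afterSum_reverse, h, ← beforeSum_descOver_word t 0]
  rfl

theorem vinc2_13_mul_rev (h : permWord π = word t 0) :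
    vinc2_13 (π * Fin.revPerm) = tree31_2 t := by
  rw [vinc2_13_eq_beforeSum, permWord_mul_rev, beforeSum_reverse, h, ← afterSum_descOver_word t 0]
  rfl

/-- Reversing an alternating word of even length interchanges starting with a descent and starting
with an ascent. -/
theorem isAlternating_mul_rev (hn : Even n) (h : permWord π = word t 0) :
    IsAlternating (π * Fin.revPerm) ↔ TreeAltEven t := by
  have hb : t.numNodes.bodd = false := by
    rw [numNodes_of_permWord h, ← even_iff_bodd]
    exact hn
  rw [isAlternating_iff_altFrom, permWord_mul_rev, h, altFrom_reverse (by rwa [length_word]),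
    (altFrom_word t 0).1]
  simp [hb]

end Transfer

/-! ### Extraction of coefficients -/

section Sums

variable {R : Type*} [CommRing R]

open Classical in
theorem sum_coderAvoiding_132 {n : ℕ} (f : Equiv.Perm (Fin n) → R) (g : BinaryTree Unit → R)
    (h : ∀ π t, permWord π = word t 0 → f π = g t) :
    ∑ π ∈ coderAvoiding n ![1, 3, 2], f π =
      PowerSeries.coeff n (treeGF fun t => if TreeCoder t then g t else 0) := by
  have : coderAvoiding n ![1, 3, 2] = (avoiding n ![1, 3, 2]).filter fun π => fmax π = 0 := by
    ext π; simp [coderAvoiding, avoiding, and_comm]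
  rw [this, Finset.sum_filter, coeff_treeGF]
  exact sum_avoiding_132 _ _ fun π t hπ => by
    rw [h π t hπ]
    exact if_congr (fmax_of_permWord hπ) rfl rfl

open Classical in
theorem sum_coderAvoiding_213 {n : ℕ} (f : Equiv.Perm (Fin n) → R) (g : BinaryTree Unit → R)
    (h : ∀ π t, permWord π = word t 0 → f (Fin.revPerm * (π * Fin.revPerm)) = g t) :
    ∑ π ∈ coderAvoiding n ![2, 1, 3], f π =
      PowerSeries.coeff n (treeGF fun t => if TreeRevCoder t then g t else 0) := by
  have : coderAvoiding n ![2, 1, 3] = (avoiding n ![2, 1, 3]).filter fun π => fmax π = 0 := by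
    ext π; simp [coderAvoiding, avoiding, and_comm]
  rw [this, Finset.sum_filter, coeff_treeGF]
  exact sum_avoiding_213 _ _ fun π t hπ => by
    rw [h π t hπ]
    exact if_congr (fmax_rev_mul_rev hπ) rfl rfl

open Classical in
theorem sum_altAvoiding_231 {n : ℕ} (hn : Even n) (f : Equiv.Perm (Fin n) → R)
    (g : BinaryTree Unit → R)
    (h : ∀ π t, permWord π = word t 0 → f (π * Fin.revPerm) = g t) :
    ∑ π ∈ altAvoiding n ![2, 3, 1], f π =
      ∑ t ∈ treesOfNumNodesEq n, if TreeAltEven t then g t else 0 := by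
  have : altAvoiding n ![2, 3, 1] = (avoiding n ![2, 3, 1]).filter fun π => IsAlternating π := by
    ext π; simp [altAvoiding, avoiding, and_comm]
  rw [this, Finset.sum_filter]
  exact sum_avoiding_231 _ _ fun π t hπ => by
    rw [h π t hπ]
    exact if_congr (isAlternating_mul_rev hn hπ) rfl rfl

-- Trees in `TreeAltEven` have even size, so odd coefficients vanish, and `y ^ (|t| / 2)` is
-- constant in each degree.
open Classical in
theorem coeff_treeGF_altEven (n : ℕ) (y : R) (g : BinaryTree Unit → R) :
    PowerSeries.coeff n (treeGF fun t => if TreeAltEven t then y ^ (t.numNodes / 2) * g t else 0) =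
      if Even n then y ^ (n / 2) *
        ∑ t ∈ treesOfNumNodesEq (2 * (n / 2)), (if TreeAltEven t then g t else 0) else 0 := by
  rw [coeff_treeGF]
  split_ifs with hn
  · rw [Nat.two_mul_div_two_of_even hn, Finset.mul_sum]
    refine Finset.sum_congr rfl fun t ht => ?_
    rw [mem_treesOfNumNodesEq.1 ht, mul_ite, mul_zero]
  · refine Finset.sum_eq_zero fun t ht => if_neg fun h => hn ?_
    rw [← mem_treesOfNumNodesEq.1 ht]
    exact h.even

theorem coeff_one_add_X_mul_signedCarlitz (q : R) {n : ℕ} (hn : 1 ≤ n) :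
    PowerSeries.coeff n (1 + PowerSeries.X * signedCarlitz q) =
      if Even n then 0 else (-q) ^ ((n - 1) / 2) * carlitzCatalan ((n - 1) / 2) (q ^ 2) := by
  obtain ⟨m, rfl⟩ := Nat.exists_eq_add_of_le' hn
  rw [map_add, PowerSeries.coeff_succ_X_mul, coeff_signedCarlitz, PowerSeries.coeff_one,
    if_neg m.succ_ne_zero, zero_add, Nat.add_sub_cancel]
  by_cases h : Even m <;> simp [h, Nat.even_add_one]

theorem sum_avoiding_132_vinc2_31 (q : R) {n : ℕ} (hn : 1 ≤ n) :
    ∑ π ∈ avoiding n ![1, 3, 2], (-1) ^ des π * q ^ vinc2_31 π =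
      if Even n then 0 else (-q) ^ ((n - 1) / 2) * carlitzCatalan ((n - 1) / 2) (q ^ 2) := by
  rw [← coeff_one_add_X_mul_signedCarlitz q hn, ← treeGF_signed_2_31, coeff_treeGF]
  exact sum_avoiding_132 _ _ fun π t h => by
    rw [wt2_31, des_of_permWord h, vinc2_31_of_permWord h]

theorem sum_avoiding_132_vinc2_13 (q : R) {n : ℕ} (hn : 1 ≤ n) :
    ∑ π ∈ avoiding n ![1, 3, 2], (-1) ^ des π * q ^ vinc2_13 π =
      if Even n then 0 else (-q) ^ ((n - 1) / 2) * carlitzCatalan ((n - 1) / 2) (q ^ 2) := by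
  rw [← coeff_one_add_X_mul_signedCarlitz q hn, ← treeGF_signed_2_13, coeff_treeGF]
  exact sum_avoiding_132 _ _ fun π t h => by
    rw [wt2_13, des_of_permWord h, vinc2_13_of_permWord h, one_pow, mul_one]

theorem sum_avoiding_213_vinc31_2 (q : R) {n : ℕ} (hn : 1 ≤ n) :
    ∑ π ∈ avoiding n ![2, 1, 3], (-1) ^ des π * q ^ vinc31_2 π =
      if Even n then 0 else (-q) ^ ((n - 1) / 2) * carlitzCatalan ((n - 1) / 2) (q ^ 2) := by
  rw [← coeff_one_add_X_mul_signedCarlitz q hn, ← treeGF_signed_2_31, coeff_treeGF]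
  exact sum_avoiding_213 _ _ fun π t h => by
    rw [wt2_31, des_rev_mul_rev h, vinc31_2_rev_mul_rev h]

theorem sum_avoiding_213_vinc13_2 (q : R) {n : ℕ} (hn : 1 ≤ n) :
    ∑ π ∈ avoiding n ![2, 1, 3], (-1) ^ des π * q ^ vinc13_2 π =
      if Even n then 0 else (-q) ^ ((n - 1) / 2) * carlitzCatalan ((n - 1) / 2) (q ^ 2) := by
  rw [← coeff_one_add_X_mul_signedCarlitz q hn, ← treeGF_signed_2_13, coeff_treeGF]
  exact sum_avoiding_213 _ _ fun π t h => by
    rw [wt2_13, des_rev_mul_rev h, vinc13_2_rev_mul_rev h, one_pow, mul_one]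

theorem neg_one_pow_des_rev_mul {n : ℕ} {π : Equiv.Perm (Fin n)} {t : BinaryTree Unit}
    (h : permWord π = word t 0) :
    (-1 : R) ^ des (Fin.revPerm * π) = (-1) ^ (n - 1) * (-1) ^ treeDes t := by
  rw [← des_rev_mul_add h, pow_add, mul_assoc, ← mul_pow, neg_one_mul, neg_neg, one_pow, mul_one]

theorem neg_one_pow_mul_coeff (q : R) {n : ℕ} (hn : 1 ≤ n) :
    (-1) ^ (n - 1) * PowerSeries.coeff n (1 + PowerSeries.X * signedCarlitz q) =
      if Even n then 0 else (-q) ^ ((n - 1) / 2) * carlitzCatalan ((n - 1) / 2) (q ^ 2) := by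
  rw [coeff_one_add_X_mul_signedCarlitz q hn]
  split_ifs with h
  · rw [mul_zero]
  · rw [Even.neg_one_pow (Nat.Odd.sub_odd (Nat.not_even_iff_odd.1 h) odd_one), one_mul]

theorem sum_avoiding_312_vinc2_31 (q : R) {n : ℕ} (hn : 1 ≤ n) :
    ∑ π ∈ avoiding n ![3, 1, 2], (-1) ^ des π * q ^ vinc2_31 π =
      if Even n then 0 else (-q) ^ ((n - 1) / 2) * carlitzCatalan ((n - 1) / 2) (q ^ 2) := by
  rw [← neg_one_pow_mul_coeff q hn, ← treeGF_signed_2_13, coeff_treeGF, Finset.mul_sum]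
  exact sum_avoiding_312 _ _ fun π t h => by
    rw [wt2_13, neg_one_pow_des_rev_mul h, vinc2_31_rev_mul h, one_pow, mul_one, mul_assoc]

theorem sum_avoiding_312_vinc2_13 (q : R) {n : ℕ} (hn : 1 ≤ n) :
    ∑ π ∈ avoiding n ![3, 1, 2], (-1) ^ des π * q ^ vinc2_13 π =
      if Even n then 0 else (-q) ^ ((n - 1) / 2) * carlitzCatalan ((n - 1) / 2) (q ^ 2) := by
  rw [← neg_one_pow_mul_coeff q hn, ← treeGF_signed_2_31, coeff_treeGF, Finset.mul_sum]
  exact sum_avoiding_312 _ _ fun π t h => by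
    rw [wt2_31, neg_one_pow_des_rev_mul h, vinc2_13_rev_mul h, mul_assoc]

theorem sum_coderAvoiding_132_vinc2_31 (q : R) (n : ℕ) :
    ∑ π ∈ coderAvoiding n ![1, 3, 2], (-1) ^ des π * q ^ vinc2_31 π =
      if Even n then (-1) ^ (n / 2) * catalanHat (n / 2) q else 0 := by
  rw [sum_coderAvoiding_132 _ (wt2_31 (-1) q) fun π t h => by
    rw [wt2_31, des_of_permWord h, vinc2_31_of_permWord h], treeGF_coder_2_31_eq,
    coeff_treeGF_altEven, catalanHat, sum_altAvoiding_231 (even_two_mul _) _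
      (fun t => q ^ tree2_31 t) fun π t h => by rw [vinc13_2_mul_rev h]]

theorem sum_coderAvoiding_132_vinc31_2 (q : R) (n : ℕ) :
    ∑ π ∈ coderAvoiding n ![1, 3, 2], (-q) ^ des π * q ^ vinc31_2 π =
      if Even n then (-q) ^ (n / 2) * catalanBar (n / 2) q else 0 := by
  rw [sum_coderAvoiding_132 _ (wt31_2 (-q) 1 q) fun π t h => by
    rw [wt31_2, des_of_permWord h, vinc31_2_of_permWord h, one_pow, mul_one],
    treeGF_coder_31_2_eq, coeff_treeGF_altEven, catalanBar,
    sum_altAvoiding_231 (even_two_mul _) _ (fun t => q ^ tree31_2 t)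
      fun π t h => by rw [vinc2_13_mul_rev h]]

theorem sum_coderAvoiding_213_vinc13_2 (q : R) {n : ℕ} (hn : 1 ≤ n) :
    ∑ π ∈ coderAvoiding n ![2, 1, 3], (-1) ^ des π * q ^ vinc13_2 π =
      if Even n then (-1) ^ (n / 2) * q ^ ((n - 2) / 2) * carlitzCatalan ((n - 2) / 2) (q ^ 2)
      else 0 := by
  rw [sum_coderAvoiding_213 _ (wt2_13 1 q) fun π t h => by
    rw [wt2_13, des_rev_mul_rev h, vinc13_2_rev_mul_rev h, one_pow, mul_one],
    treeGF_revCoder_2_13, map_sub, PowerSeries.coeff_one, if_neg (by omega), zero_sub,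
    PowerSeries.coeff_X_pow_mul', coeff_signedCarlitz]
  rcases Nat.even_or_odd' n with ⟨m, rfl | rfl⟩
  · obtain ⟨m, rfl⟩ : ∃ k, m = k + 1 := ⟨m - 1, by omega⟩
    have h1 : 2 * (m + 1) - 2 = 2 * m := by omega
    have h2 : 2 * m / 2 = m := by omega
    have h3 : 2 * (m + 1) / 2 = m + 1 := by omega
    rw [if_pos (by omega), h1, if_pos (even_two_mul _), if_pos (even_two_mul _), h2, h3, neg_pow]
    ring
  · rw [if_neg (Nat.not_even_two_mul_add_one m)]
    split_ifs with h1 h2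
    · grind
    · simp
    · simp

theorem sum_coderAvoiding_213_vinc31_2 (q : R) {n : ℕ} (hn : 1 ≤ n) :
    ∑ π ∈ coderAvoiding n ![2, 1, 3], (-q) ^ des π * q ^ vinc31_2 π =
      if Even n then
        (-1) ^ (n / 2) * q ^ ((3 * n - 4) / 2) * carlitzCatalan ((n - 2) / 2) (q ^ 2)
      else 0 := by
  rw [sum_coderAvoiding_213 _ (wt2_31 (-q) q) fun π t h => by
    rw [wt2_31, des_rev_mul_rev h, vinc31_2_rev_mul_rev h],
    treeGF_revCoder_2_31, map_sub, PowerSeries.coeff_one, if_neg (by omega), zero_sub, mul_assoc,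
    PowerSeries.coeff_C_mul, PowerSeries.coeff_X_pow_mul', PowerSeries.coeff_rescale,
    coeff_signedCarlitz]
  rcases Nat.even_or_odd' n with ⟨m, rfl | rfl⟩
  · obtain ⟨m, rfl⟩ : ∃ k, m = k + 1 := ⟨m - 1, by omega⟩
    have h1 : 2 * (m + 1) - 2 = 2 * m := by omega
    have h2 : 2 * m / 2 = m := by omega
    have h3 : 2 * (m + 1) / 2 = m + 1 := by omega
    -- The exponent collects `1` from the factor `C q`, `2m` from the dilation and `m` from `(-q) ^
    -- m`.
    have h4 : (3 * (2 * (m + 1)) - 4) / 2 = 3 * m + 1 := by omega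
    rw [if_pos (by omega), h1, if_pos (even_two_mul _), if_pos (even_two_mul _), h2, h3, h4,
      neg_pow]
    ring
  · rw [if_neg (Nat.not_even_two_mul_add_one m)]
    split_ifs with h1 h2
    · grind
    · simp
    · simp

end Sums

end QCatalan

theorem mainTheorem6 {R : Type*} [CommRing R] (q : R) (n : ℕ) (hn : 1 ≤ n) :
    (∑ π ∈ avoiding n ![1, 3, 2], (-1) ^ des π * q ^ vinc2_31 π =
        ∑ π ∈ avoiding n ![1, 3, 2], (-1) ^ des π * q ^ vinc2_13 π ∧
      ∑ π ∈ avoiding n ![1, 3, 2], (-1) ^ des π * q ^ vinc2_13 π =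
        if Even n then 0 else (-q) ^ ((n - 1) / 2) * carlitzCatalan ((n - 1) / 2) (q ^ 2)) ∧
    (∑ π ∈ avoiding n ![2, 1, 3], (-1) ^ des π * q ^ vinc31_2 π =
        ∑ π ∈ avoiding n ![2, 1, 3], (-1) ^ des π * q ^ vinc13_2 π ∧
      ∑ π ∈ avoiding n ![2, 1, 3], (-1) ^ des π * q ^ vinc13_2 π =
        if Even n then 0 else (-q) ^ ((n - 1) / 2) * carlitzCatalan ((n - 1) / 2) (q ^ 2)) ∧
    (∑ π ∈ avoiding n ![3, 1, 2], (-1) ^ des π * q ^ vinc2_31 π =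
        ∑ π ∈ avoiding n ![3, 1, 2], (-1) ^ des π * q ^ vinc2_13 π ∧
      ∑ π ∈ avoiding n ![3, 1, 2], (-1) ^ des π * q ^ vinc2_13 π =
        if Even n then 0 else (-q) ^ ((n - 1) / 2) * carlitzCatalan ((n - 1) / 2) (q ^ 2)) ∧
    (∑ π ∈ coderAvoiding n ![1, 3, 2], (-1) ^ des π * q ^ vinc2_31 π =
        if Even n then (-1) ^ (n / 2) * catalanHat (n / 2) q else 0) ∧
    (∑ π ∈ coderAvoiding n ![1, 3, 2], (-q) ^ des π * q ^ vinc31_2 π =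
        if Even n then (-q) ^ (n / 2) * catalanBar (n / 2) q else 0) ∧
    (∑ π ∈ coderAvoiding n ![2, 1, 3], (-1) ^ des π * q ^ vinc13_2 π =
        if Even n then
          (-1) ^ (n / 2) * q ^ ((n - 2) / 2) * carlitzCatalan ((n - 2) / 2) (q ^ 2)
        else 0) ∧
    (∑ π ∈ coderAvoiding n ![2, 1, 3], (-q) ^ des π * q ^ vinc31_2 π =
        if Even n then
          (-1) ^ (n / 2) * q ^ ((3 * n - 4) / 2) * carlitzCatalan ((n - 2) / 2) (q ^ 2)
        else 0) := by
  refine ⟨⟨?_, sum_avoiding_132_vinc2_13 q hn⟩, ⟨?_, sum_avoiding_213_vinc13_2 q hn⟩,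
    ⟨?_, sum_avoiding_312_vinc2_13 q hn⟩, sum_coderAvoiding_132_vinc2_31 q n,
    sum_coderAvoiding_132_vinc31_2 q n, sum_coderAvoiding_213_vinc13_2 q hn,
    sum_coderAvoiding_213_vinc31_2 q hn⟩
  · rw [sum_avoiding_132_vinc2_31 q hn, sum_avoiding_132_vinc2_13 q hn]
  · rw [sum_avoiding_213_vinc31_2 q hn, sum_avoiding_213_vinc13_2 q hn]
  · rw [sum_avoiding_312_vinc2_31 q hn, sum_avoiding_312_vinc2_13 q hn]
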